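/- Let $H$ be a complex separable Hilbert space. An operator means a bounded linear operator on $H$; it is called positive, written $A\ge 0$, if it is selfadjoint and $\langle Ax,x\rangle\ge 0$ for all $x$; invertible means having a bounded inverse. For an operator $T$ write $\sigma(T)\ge 0$ if its spectrum satisfies $\sigma(T)\subseteq[0,\infty)$. An operator $T$ is called scalar if there are (not necessarily orthogonal) projections $E(\omega)$, one for each Borel set $\omega\subseteq\mathbb C$, which are uniformly bounded, countably additive in the strong operator topology, satisfy $E(\mathbb C)=1$ and $E(\omega\cap\delta)=E(\omega)E(\delta)$, commute with $T$, satisfy $\sigma(T|_{\operatorname{ran}E(\omega)})\subseteq\overline{\omega}$ for every $\omega$, and are such that $T=\int_{\sigma(T)}\lambda\,dE(\lambda)$, the integral being the operator norm limit of the integrals of Borel simple functions converging uniformly on $\sigma(T)$ to $\lambda\mapsto\lambda$. Theorem. Let $T$ be an operator on $H$. The following statements are equivalent: (i) $TG=GS$ for some invertible operator $G$ and some positive operator $S$; (ii) $TX=XT^*$ for some invertible positive operator $X$, and $\sigma(T)\ge 0$; (iii) $T=AB$ for some positive operators $A,B$ with $B$ invertible; (iii$'$) $T=AB$ for some positive operators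 $A,B$ with $A$ invertible; (iv) there is an invertible positive operator $W$ such that $TW\ge 0$; (iv$'$) there is an invertible positive operator $Z$ such that $ZT\ge 0$; (v) $T$ is a scalar operator and $\sigma(T)\ge 0$. If any of these hold, then $\overline{\operatorname{ran}}\,T\cap\ker T=\{0\}$ and $\overline{\operatorname{ran}}\,T+\ker T=H$. -/

import Mathlib

open Filter Topology MeasureTheory

namespace ScalarOperators

variable {H : Type*} [NormedAddCommGroup H] [InnerProductSpace ℂ H]

/-- If `P` commutes with `T`, then the range of `P` is invariant under `T`. -/
theorem mapsTo_range_of_commute {P T : H →L[ℂ] H} (h : Commute P T) :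
    ∀ x ∈ P.range, T x ∈ P.range := by
  rintro _ ⟨y, rfl⟩
  exact ⟨T y, congrArg (fun A : H →L[ℂ] H => A y) h.eq⟩

/-- The integral `∑ c, c • E (s⁻¹ {c} ∩ K)` over `K` of a simple function `s` with respect to an
operator valued set function `E`. -/
noncomputable def simpleIntegral (E : Set ℂ → H →L[ℂ] H) (K : Set ℂ) (s : SimpleFunc ℂ ℂ) :
    H →L[ℂ] H :=
  ∑ c ∈ s.range, c • E (s ⁻¹' {c} ∩ K)

/-- `T = ∫_K f dE`: the operator `T` is the limit in operator norm of the integrals of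
(Borel) simple functions that converge to `f` uniformly on `K`. -/
def HasSpectralIntegral (E : Set ℂ → H →L[ℂ] H) (K : Set ℂ) (f : ℂ → ℂ) (T : H →L[ℂ] H) : Prop :=
  ∃ s : ℕ → SimpleFunc ℂ ℂ, TendstoUniformlyOn (fun n z => s n z) f atTop K ∧
    Tendsto (fun n => simpleIntegral E K (s n)) atTop (𝓝 T)

/-- `E` is a resolution of the identity for `T`: a uniformly bounded, (strongly) countably additive
family of (not necessarily orthogonal) projections indexed by the Borel subsets of `ℂ` (the values
at other sets play no role), multiplicative, with `E ℂ = 1`, commuting with `T`, and such that the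
spectrum of the restriction of `T` to the range of `E ω` is contained in the closure of `ω`. -/
structure IsResolutionOfIdentity (T : H →L[ℂ] H) (E : Set ℂ → H →L[ℂ] H) : Prop where
  idempotent : ∀ ω, MeasurableSet ω → IsIdempotentElem (E ω)
  univ : E Set.univ = 1
  inter : ∀ ω δ, MeasurableSet ω → MeasurableSet δ → E (ω ∩ δ) = E ω * E δ
  hasSum : ∀ ω : ℕ → Set ℂ, (∀ i, MeasurableSet (ω i)) → Pairwise (Function.onFun Disjoint ω) →
    ∀ x : H, HasSum (fun i => E (ω i) x) (E (⋃ i, ω i) x)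
  bounded : ∃ M : ℝ, ∀ ω, MeasurableSet ω → ‖E ω‖ ≤ M
  commute : ∀ ω, MeasurableSet ω → Commute (E ω) T
  spectrum_subset : ∀ ω (hω : MeasurableSet ω),
    spectrum ℂ (T.restrict (mapsTo_range_of_commute (commute ω hω)) :
      (E ω).range →L[ℂ] (E ω).range) ⊆ closure ω

/-- `T` is a scalar operator: it is spectral, i.e. it has a resolution of the identity `E`, and
moreover `T = ∫_{σ(T)} z dE(z)`. -/
def IsScalarOperator (T : H →L[ℂ] H) : Prop :=
  ∃ E : Set ℂ → H →L[ℂ] H,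
    IsResolutionOfIdentity T E ∧ HasSpectralIntegral E (spectrum ℂ T) (fun z => z) T

/-- `σ(T) ≥ 0`: the spectrum of `T` is contained in `[0, ∞)`. -/
def SpectrumNonneg (T : H →L[ℂ] H) : Prop :=
  spectrum ℂ T ⊆ (fun r : ℝ => (r : ℂ)) '' Set.Ici 0

end ScalarOperators

/-! Every condition is compared with similarity to a positive operator, T = G S G⁻¹. For the product
and symmetrizer conditions this is algebra. An invertible positive operator is R² with R selfadjoint
and invertible, and conjugating A B by R or R⁻¹ gives R B R or R A R; the operator G G* symmetrizes
G S G⁻¹. With X = R², the relation T X = X T* makes R⁻¹ T R selfadjoint, and its spectrum, unchanged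
by similarity, makes it positive. For selfadjoint S the closed range and the kernel are orthogonal
complements, and G carries this splitting to T.

The analysis concerns scalar operators. To reach them from similarity, the spectral resolution of a
normal S is built from measures μ_x with ‖g(S)x‖ = ‖g‖ in L²(μ_x) (`enorm_cfc_apply`): the
functional calculus extends isometrically to indicators, which yields orthogonal projections, and
conjugation by G gives a resolution for T (`isScalarOperator_units_conj`).

Conversely, for a partition with projections P_i, uniform boundedness bounds all signed sums ∑ ±P_i
by a constant independent of the partition. The parallelogram law then makes ∑ ‖P_i x‖² comparable
to ‖x‖² with uniform constants (`sum_norm_sq_le`, `norm_sq_le_sum`). A weak ultrafilter limit Z of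
the operators ∑ P_i* P_i, along simple approximations of T, is positive and invertible, and Z T is
positive (`IsScalarOperator.exists_isPositive_mul`). -/

open scoped ENNReal InnerProductSpace

namespace ScalarOperators

/-! ### Spectral measures of a normal operator and the construction of its projections -/

section SpectralMeasures

variable {H : Type*} [NormedAddCommGroup H] [InnerProductSpace ℂ H] [CompleteSpace H]

section SpectralMeasure

variable (S : H →L[ℂ] H) [hS : IsStarNormal S]

/-- The composition of a real function on the spectrum with the inclusion of `ℝ` into `ℂ`. -/
noncomputable def complexify {X : Type*} [TopologicalSpace X] (f : C(X, ℝ)) : C(X, ℂ) :=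
  ⟨fun z => (f z : ℂ), by fun_prop⟩

theorem norm_cfcHom_apply_sq (g : C(spectrum ℂ S, ℂ)) (x : H) :
    ‖cfcHom hS g x‖ ^ 2 = (inner ℂ (cfcHom hS (star g * g) x) x).re := by
  rw [map_mul, map_star, ContinuousLinearMap.star_eq_adjoint, mul_apply_eq_comp,
    ContinuousLinearMap.adjoint_inner_left, inner_self_eq_norm_sq_to_K]
  norm_cast

/-- The positive functional `f ↦ ⟪f(S) x, x⟫` on the continuous functions on the spectrum. -/
noncomputable def spectralFunctional (x : H) :
    CompactlySupportedContinuousMap (spectrum ℂ S) ℝ →ₚ[ℝ] ℝ :=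
  PositiveLinearMap.mk₀
    { toFun := fun f => (inner ℂ (cfcHom hS (complexify f.toContinuousMap) x) x).re
      map_add' := by
        intro f g
        have : complexify (f + g).toContinuousMap
            = complexify f.toContinuousMap + complexify g.toContinuousMap := by
          ext z; simp [complexify]
        rw [this, map_add, add_apply, inner_add_left, Complex.add_re]
      map_smul' := by
        intro c f
        have : complexify (c • f).toContinuousMap = (c : ℂ) • complexify f.toContinuousMap := by
          ext z; simp [complexify]
        rw [this, map_smul, smul_apply, inner_smul_left]
        simp }
    (by
      intro f hf
      -- With h = √f, the value at f ≥ 0 becomes ‖h(S)x‖².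
      have : complexify f.toContinuousMap
          = star (complexify (⟨fun z => Real.sqrt (f z), by fun_prop⟩ : C(spectrum ℂ S, ℝ)))
            * complexify (⟨fun z => Real.sqrt (f z), by fun_prop⟩ : C(spectrum ℂ S, ℝ)) := by
        ext z
        have h0 : 0 ≤ f z := hf z
        simp only [complexify, ContinuousMap.coe_mk, ContinuousMap.mul_apply,
          ContinuousMap.star_apply, RCLike.star_def, Complex.conj_ofReal, ← Complex.ofReal_mul,
          Real.mul_self_sqrt h0]
        rfl
      change 0 ≤ (inner ℂ (cfcHom hS (complexify f.toContinuousMap) x) x).re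
      rw [this, ← norm_cfcHom_apply_sq]
      positivity)

/-- The measure on `ℂ` with `∫ f dμ = ⟪f(S) x, x⟫` for continuous functions `f`. -/
noncomputable def spectralMeasure (x : H) : Measure ℂ :=
  (RealRMK.rieszMeasure (spectralFunctional S x)).map Subtype.val

instance (x : H) : IsFiniteMeasureOnCompacts (RealRMK.rieszMeasure (spectralFunctional S x)) := by
  unfold RealRMK.rieszMeasure; infer_instance

instance (x : H) : IsFiniteMeasure (spectralMeasure S x) := by
  unfold spectralMeasure
  infer_instance

theorem ae_mem_spectrum (x : H) : ∀ᵐ z ∂spectralMeasure S x, z ∈ spectrum ℂ S := by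
  have hm : MeasurableSet {z | z ∈ spectrum ℂ S} :=
    (spectrum.isClosed (𝕜 := ℂ) S).measurableSet
  rw [spectralMeasure, ae_map_iff measurable_subtype_coe.aemeasurable hm]
  exact Filter.Eventually.of_forall fun z => z.2

/-- The square of the left side is ⟪(ḡg)(S)x, x⟫, the integral of |g|². This isometry is what allows
the calculus to go beyond continuous functions. -/
theorem enorm_cfc_apply {g : ℂ → ℂ} (hg : Continuous g) (x : H) :
    ‖cfc g S x‖ₑ = eLpNorm g 2 (spectralMeasure S x) := by
  set ν := RealRMK.rieszMeasure (spectralFunctional S x) with hν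
  set h : C(spectrum ℂ S, ℂ) := ⟨fun z => g z, by fun_prop⟩ with hh
  have h1 : cfc g S = cfcHom hS h := cfc_apply g S hS hg.continuousOn
  let k : CompactlySupportedContinuousMap (spectrum ℂ S) ℝ :=
    CompactlySupportedContinuousMap.continuousMapEquiv ⟨fun z => ‖g z‖ ^ 2, by fun_prop⟩
  have hk : star h * h = complexify k.toContinuousMap := by
    ext z
    simp only [complexify, ContinuousMap.mul_apply, ContinuousMap.star_apply, RCLike.star_def,
      hh, ContinuousMap.coe_mk]
    rw [mul_comm, Complex.mul_conj, Complex.normSq_eq_norm_sq]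
    rfl
  have h2 : ‖cfc g S x‖ ^ 2 = ∫ z, k z ∂ν := by
    rw [hν, RealRMK.integral_rieszMeasure, h1, norm_cfcHom_apply_sq, hk]
    rfl
  have h3 : eLpNorm g 2 (spectralMeasure S x) ^ 2 = ‖cfc g S x‖ₑ ^ 2 := by
    rw [spectralMeasure, eLpNorm_map_measure hg.aestronglyMeasurable
      measurable_subtype_coe.aemeasurable]
    have := eLpNorm_nnreal_pow_eq_lintegral (f := g ∘ Subtype.val) (μ := ν) (p := 2) (by norm_num)
    norm_num at this
    rw [this, ← ofReal_norm, ← ENNReal.ofReal_pow (norm_nonneg _), h2,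
      ofReal_integral_eq_lintegral_ofReal]
    · refine lintegral_congr fun z => ?_
      rw [← ofReal_norm, ← ENNReal.ofReal_pow (norm_nonneg _)]
      rfl
    · exact k.integrable
    · exact Filter.Eventually.of_forall fun z => sq_nonneg ‖g z‖
  exact ((ENNReal.pow_right_strictMono two_ne_zero).injective h3).symm

theorem memLp_of_continuous {g : ℂ → ℂ} (hg : Continuous g) (x : H) :
    MemLp g 2 (spectralMeasure S x) :=
  ⟨hg.aestronglyMeasurable, by rw [← enorm_cfc_apply S hg x]; exact enorm_lt_top⟩

/-- The map `g ↦ g(S) x` on continuous functions. -/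
noncomputable def cfcApply (x : H) : C(ℂ, ℂ) →ₗ[ℂ] H where
  toFun g := cfc g S x
  map_add' f g := by
    have := cfc_add (a := S) f g (by fun_prop) (by fun_prop)
    exact congrArg (fun A : H →L[ℂ] H => A x) this
  map_smul' c g := by
    have := cfc_smul (a := S) c g (by fun_prop)
    exact congrArg (fun A : H →L[ℂ] H => A x) this

/-- The map sending a continuous function to its class in `L²` of the spectral measure. -/
noncomputable def continuousToLp (x : H) : C(ℂ, ℂ) →ₗ[ℂ] Lp ℂ 2 (spectralMeasure S x) where
  toFun g := (memLp_of_continuous S g.continuous x).toLp g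
  map_add' _ _ := rfl
  map_smul' _ _ := rfl

theorem denseRange_continuousToLp (x : H) : DenseRange (continuousToLp S x) := by
  refine (BoundedContinuousFunction.toLp_denseRange ℂ (spectralMeasure S x) (p := 2) ℂ
    (by norm_num)).mono ?_
  rintro _ ⟨f, rfl⟩
  exact ⟨f.toContinuousMap, rfl⟩

theorem norm_continuousToLp (x : H) (g : C(ℂ, ℂ)) : ‖continuousToLp S x g‖ = ‖cfcApply S x g‖ := by
  change ‖(memLp_of_continuous S g.continuous x).toLp g‖ = ‖cfc g S x‖
  rw [Lp.norm_toLp, ← enorm_cfc_apply S g.continuous x, toReal_enorm]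

/-- The vector y is the image of the indicator under the isometric extension of g ↦ g(S)x to L². Its
distance to every g(S)x determines it, and turns L² approximation of the indicator into convergence
in H. -/
theorem exists_enorm_cfc_apply_sub (x : H) {ω : Set ℂ} (hω : MeasurableSet ω) :
    ∃ y : H, ∀ g : ℂ → ℂ, Continuous g →
      ‖cfc g S x - y‖ₑ = eLpNorm (g - ω.indicator 1) 2 (spectralMeasure S x) := by
  set V := (cfcApply S x).extendOfNorm (continuousToLp S x) with hV
  have hbound : ∀ g, ‖cfcApply S x g‖ ≤ 1 * ‖continuousToLp S x g‖ := fun g => by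
    rw [one_mul, norm_continuousToLp]
  have hext : ∀ g, V (continuousToLp S x g) = cfcApply S x g := fun g =>
    LinearMap.extendOfNorm_eq (denseRange_continuousToLp S x) ⟨1, hbound⟩ g
  have hiso : ∀ u, ‖V u‖ = ‖u‖ := fun u => by
    refine (denseRange_continuousToLp S x).induction_on u
      (isClosed_eq (by fun_prop) (by fun_prop)) fun g => ?_
    rw [hext, norm_continuousToLp]
  have hmem : MemLp (ω.indicator (1 : ℂ → ℂ)) 2 (spectralMeasure S x) :=
    (memLp_const (1 : ℂ)).indicator hω
  refine ⟨V (hmem.toLp _), fun g hg => ?_⟩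
  have h1 : cfc g S x - V (hmem.toLp _)
      = V (((memLp_of_continuous S hg x).sub hmem).toLp (g - ω.indicator 1)) := by
    rw [MemLp.toLp_sub (memLp_of_continuous S hg x) hmem, map_sub]
    congr 1
    exact (hext ⟨g, hg⟩).symm
  rw [h1, ← ofReal_norm, hiso, ofReal_norm, Lp.enorm_toLp]

/-- Allowing any finite measure lets a sum of spectral measures be used, so that one sequence serves
several vectors at once. The bounds 0 and 1 later keep the operators f_n(S) contractive. -/
theorem exists_continuous_approx (μ : Measure ℂ) [IsFiniteMeasure μ] {ω : Set ℂ}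
    (hω : MeasurableSet ω) :
    ∃ f : ℕ → ℂ → ℝ, (∀ n, Continuous (f n)) ∧ (∀ n z, 0 ≤ f n z ∧ f n z ≤ 1) ∧
      Tendsto (fun n => eLpNorm ((fun z => (f n z : ℂ)) - ω.indicator 1) 2 μ) atTop (𝓝 0) := by
  have hmem : MemLp (ω.indicator (1 : ℂ → ℝ)) 2 μ := (memLp_const (1 : ℝ)).indicator hω
  have key : ∀ n : ℕ, ∃ f : ℂ → ℝ, Continuous f ∧ (∀ z, 0 ≤ f z ∧ f z ≤ 1) ∧
      eLpNorm ((fun z => (f z : ℂ)) - ω.indicator 1) 2 μ ≤ ((n : ℝ≥0∞) + 1)⁻¹ := by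
    intro n
    obtain ⟨g, hg, -⟩ := hmem.exists_boundedContinuous_eLpNorm_sub_le (by norm_num)
      (ε := ((n : ℝ≥0∞) + 1)⁻¹) (by simp)
    -- Clipping to [0, 1] cannot increase the distance to an indicator.
    refine ⟨fun z => max 0 (min 1 (g z)), by fun_prop, fun z => ⟨by simp, by simp⟩, ?_⟩
    refine (eLpNorm_mono fun z => ?_).trans hg
    simp only [Pi.sub_apply]
    by_cases hz : z ∈ ω
    · simp only [Set.indicator_of_mem hz, Pi.one_apply]
      rw [← Complex.ofReal_one, ← Complex.ofReal_sub, Complex.norm_real, Real.norm_eq_abs,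
        Real.norm_eq_abs]
      have h0 : max 0 (min 1 (g z)) ≤ 1 := by simp
      rw [abs_of_nonpos (by linarith)]
      rcases le_total (g z) 1 with h | h
      · rw [min_eq_right h, abs_of_nonneg (by linarith)]
        linarith [le_max_right 0 (g z)]
      · rw [min_eq_left h]; simp
    · simp only [Set.indicator_of_notMem hz, sub_zero, zero_sub, norm_neg]
      rw [Complex.norm_real, Real.norm_eq_abs, Real.norm_eq_abs, abs_of_nonneg (by simp)]
      exact max_le (abs_nonneg _) ((min_le_right _ _).trans (le_abs_self _))
  choose f hf using key
  refine ⟨f, fun n => (hf n).1, fun n => (hf n).2.1, ?_⟩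
  refine tendsto_of_tendsto_of_tendsto_of_le_of_le tendsto_const_nhds ?_ (fun _ => zero_le)
    fun n => (hf n).2.2
  have := (tendsto_add_atTop_iff_nat 1).2 ENNReal.tendsto_inv_nat_nhds_zero
  simpa using this

/-- The spectral projection `E ω` of a normal operator as a function on `H`. -/
noncomputable def spectralProjFun (ω : Set ℂ) (x : H) : H :=
  open Classical in
  -- The value 0 at non-Borel sets keeps the map linear and contractive for every ω.
  if hω : MeasurableSet ω then (exists_enorm_cfc_apply_sub S x hω).choose else 0

theorem enorm_cfc_apply_sub_spectralProjFun {ω : Set ℂ} (hω : MeasurableSet ω) (x : H)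
    {g : ℂ → ℂ} (hg : Continuous g) :
    ‖cfc g S x - spectralProjFun S ω x‖ₑ
      = eLpNorm (g - ω.indicator 1) 2 (spectralMeasure S x) := by
  rw [spectralProjFun, dif_pos hω]
  exact (exists_enorm_cfc_apply_sub S x hω).choose_spec g hg

theorem tendsto_spectralProjFun {ω : Set ℂ} (hω : MeasurableSet ω) {x : H}
    {μ : Measure ℂ} (hμ : spectralMeasure S x ≤ μ) {f : ℕ → ℂ → ℂ} (hf : ∀ n, Continuous (f n))
    (h : Tendsto (fun n => eLpNorm (f n - ω.indicator 1) 2 μ) atTop (𝓝 0)) :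
    Tendsto (fun n => cfc (f n) S x) atTop (𝓝 (spectralProjFun S ω x)) := by
  rw [tendsto_iff_edist_tendsto_0]
  refine tendsto_of_tendsto_of_tendsto_of_le_of_le tendsto_const_nhds h (fun _ => zero_le)
    fun n => ?_
  simp only [edist_eq_enorm_sub]
  rw [enorm_cfc_apply_sub_spectralProjFun S hω x (hf n)]
  exact eLpNorm_mono_measure _ hμ

theorem norm_spectralProjFun_le (ω : Set ℂ) (x : H) : ‖spectralProjFun S ω x‖ ≤ ‖x‖ := by
  by_cases hω : MeasurableSet ω
  -- The choices g = 0 and g = 1 express both norms as L² norms, of the indicator and of 1.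
  · have h0 := enorm_cfc_apply_sub_spectralProjFun S hω x (g := 0) continuous_zero
    have h1 := enorm_cfc_apply S (g := 1) continuous_one x
    rw [cfc_one (R := ℂ) S, one_apply_eq_self] at h1
    rw [cfc_zero, zero_apply, zero_sub, zero_sub, enorm_neg, eLpNorm_neg] at h0
    rw [← enorm_le_iff_norm_le, h0, h1]
    exact eLpNorm_indicator_le _
  · simp [spectralProjFun, hω]

/-- The spectral projections of a normal operator. -/
noncomputable def spectralProj (ω : Set ℂ) : H →L[ℂ] H :=
  LinearMap.mkContinuous
    { toFun := spectralProjFun S ω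
      map_add' := by
        intro x y
        by_cases hω : MeasurableSet ω
        -- The vectors were chosen separately for x, y and x + y; a common approximating sequence
        -- passes additivity of f_n(S) to the limit.
        · obtain ⟨f, hf, -, h⟩ := exists_continuous_approx
            (spectralMeasure S x + spectralMeasure S y + spectralMeasure S (x + y)) hω
          have hf' : ∀ n, Continuous fun z => (f n z : ℂ) := fun n => by
            have := hf n
            fun_prop
          have hx := tendsto_spectralProjFun S hω (x := x)
            (Measure.le_add_right (Measure.le_add_right le_rfl)) hf' h
          have hy := tendsto_spectralProjFun S hω (x := y)
            (Measure.le_add_right (Measure.le_add_left le_rfl)) hf' h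
          have hxy := tendsto_spectralProjFun S hω (x := x + y)
            (Measure.le_add_left le_rfl) hf' h
          simp only [map_add] at hxy
          exact tendsto_nhds_unique hxy (hx.add hy)
        · simp [spectralProjFun, hω]
      map_smul' := by
        intro c x
        by_cases hω : MeasurableSet ω
        · obtain ⟨f, hf, -, h⟩ := exists_continuous_approx
            (spectralMeasure S x + spectralMeasure S (c • x)) hω
          have hf' : ∀ n, Continuous fun z => (f n z : ℂ) := fun n => by
            have := hf n
            fun_prop
          have hx := tendsto_spectralProjFun S hω (x := x) (Measure.le_add_right le_rfl) hf' h
          have hcx := tendsto_spectralProjFun S hω (x := c • x)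
            (Measure.le_add_left le_rfl) hf' h
          simp only [map_smul] at hcx
          exact tendsto_nhds_unique hcx (hx.const_smul c)
        · simp [spectralProjFun, hω] }
    1 (fun x => by rw [one_mul]; exact norm_spectralProjFun_le S ω x)

theorem norm_spectralProj_le (ω : Set ℂ) : ‖spectralProj S ω‖ ≤ 1 :=
  LinearMap.mkContinuous_norm_le _ zero_le_one _

theorem enorm_cfc_apply_sub_spectralProj {ω : Set ℂ} (hω : MeasurableSet ω) (x : H)
    {g : ℂ → ℂ} (hg : Continuous g) :
    ‖cfc g S x - spectralProj S ω x‖ₑ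
      = eLpNorm (g - ω.indicator 1) 2 (spectralMeasure S x) :=
  enorm_cfc_apply_sub_spectralProjFun S hω x hg

theorem tendsto_spectralProj {ω : Set ℂ} (hω : MeasurableSet ω) {x : H}
    {μ : Measure ℂ} (hμ : spectralMeasure S x ≤ μ) {f : ℕ → ℂ → ℂ} (hf : ∀ n, Continuous (f n))
    (h : Tendsto (fun n => eLpNorm (f n - ω.indicator 1) 2 μ) atTop (𝓝 0)) :
    Tendsto (fun n => cfc (f n) S x) atTop (𝓝 (spectralProj S ω x)) :=
  tendsto_spectralProjFun S hω hμ hf h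

end SpectralMeasure

end SpectralMeasures

/-! ### Algebra and countable additivity of the spectral projections -/

section SpectralProjections

variable {H : Type*} [NormedAddCommGroup H] [InnerProductSpace ℂ H] [CompleteSpace H]

theorem norm_cfc_le_one (S : H →L[ℂ] H) {f : ℂ → ℂ} (hf : ∀ z, ‖f z‖ ≤ 1) : ‖cfc f S‖ ≤ 1 :=
  norm_cfc_le zero_le_one fun z _ => hf z

section SpectralProjection

variable (S : H →L[ℂ] H) [hS : IsStarNormal S]

theorem enorm_spectralProj {ω : Set ℂ} (hω : MeasurableSet ω) (x : H) :
    ‖spectralProj S ω x‖ₑ = eLpNorm (ω.indicator (1 : ℂ → ℂ)) 2 (spectralMeasure S x) := by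
  have h0 := enorm_cfc_apply_sub_spectralProj S hω x (g := 0) continuous_zero
  rwa [cfc_zero, zero_apply, zero_sub, zero_sub, enorm_neg, eLpNorm_neg] at h0

/-- This is the dictionary by which null sets and continuity of measures become facts about the
projections. -/
theorem enorm_spectralProj_sq {ω : Set ℂ} (hω : MeasurableSet ω) (x : H) :
    ‖spectralProj S ω x‖ₑ ^ 2 = spectralMeasure S x ω := by
  rw [enorm_spectralProj S hω x]
  have := eLpNorm_nnreal_pow_eq_lintegral (f := ω.indicator (1 : ℂ → ℂ))
    (μ := spectralMeasure S x) (p := 2) (by norm_num)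
  norm_num at this
  rw [this, ← lintegral_indicator_one hω]
  refine lintegral_congr fun z => ?_
  by_cases hz : z ∈ ω <;> simp [hz]

theorem spectralProj_eq_zero_iff {ω : Set ℂ} (hω : MeasurableSet ω) (x : H) :
    spectralProj S ω x = 0 ↔ spectralMeasure S x ω = 0 := by
  rw [← enorm_spectralProj_sq S hω]
  simp

theorem spectralProj_univ : spectralProj S Set.univ = 1 := by
  ext x
  have h0 := enorm_cfc_apply_sub_spectralProj S MeasurableSet.univ x (g := 1) continuous_one
  rw [Set.indicator_univ, sub_self, eLpNorm_zero, cfc_one (R := ℂ) S, enorm_eq_zero,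
    sub_eq_zero] at h0
  exact h0.symm

/-- Split fg − 1_ω 1_δ as (f − 1_ω) g + 1_ω (g − 1_δ); the factors g and 1_ω are bounded by 1. -/
theorem tendsto_eLpNorm_indicator_mul {μ : Measure ℂ} {ω δ : Set ℂ}
    {f g : ℕ → ℂ → ℂ} (hfc : ∀ n, Continuous (f n)) (hgc : ∀ n, Continuous (g n))
    (hω : MeasurableSet ω) (hδ : MeasurableSet δ)
    (hg1 : ∀ n z, ‖g n z‖ ≤ 1)
    (hf : Tendsto (fun n => eLpNorm (f n - ω.indicator 1) 2 μ) atTop (𝓝 0))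
    (hg : Tendsto (fun n => eLpNorm (g n - δ.indicator 1) 2 μ) atTop (𝓝 0)) :
    Tendsto (fun n => eLpNorm (f n * g n - (ω ∩ δ).indicator 1) 2 μ) atTop (𝓝 0) := by
  have hsum := hf.add hg
  rw [add_zero] at hsum
  refine tendsto_of_tendsto_of_tendsto_of_le_of_le tendsto_const_nhds hsum (fun _ => zero_le)
    fun n => ?_
  have hmω : Measurable (ω.indicator (1 : ℂ → ℂ)) := measurable_one.indicator hω
  have hmδ : Measurable (δ.indicator (1 : ℂ → ℂ)) := measurable_one.indicator hδ
  have heq : f n * g n - (ω ∩ δ).indicator 1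
      = (f n - ω.indicator 1) * g n + ω.indicator 1 * (g n - δ.indicator 1) := by
    rw [Set.inter_indicator_one]
    ring
  rw [heq]
  refine (eLpNorm_add_le ?_ ?_ (by norm_num)).trans (add_le_add ?_ ?_)
  · exact (((hfc n).measurable.sub hmω).mul (hgc n).measurable).aestronglyMeasurable
  · exact (hmω.mul ((hgc n).measurable.sub hmδ)).aestronglyMeasurable
  · refine eLpNorm_mono fun z => ?_
    rw [Pi.mul_apply, norm_mul]
    exact mul_le_of_le_one_right (norm_nonneg _) (hg1 n z)
  · refine eLpNorm_mono fun z => ?_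
    rw [Pi.mul_apply, norm_mul]
    refine mul_le_of_le_one_left (norm_nonneg _) ?_
    by_cases hz : z ∈ ω <;> simp [hz]

theorem exists_approx (μ : Measure ℂ) [IsFiniteMeasure μ] {ω : Set ℂ} (hω : MeasurableSet ω) :
    ∃ f : ℕ → ℂ → ℂ, (∀ n, Continuous (f n)) ∧ (∀ n z, ‖f n z‖ ≤ 1) ∧
      (∀ n z, star (f n z) = f n z) ∧
      Tendsto (fun n => eLpNorm (f n - ω.indicator 1) 2 μ) atTop (𝓝 0) := by
  obtain ⟨f, hf, hf1, h⟩ := exists_continuous_approx μ hω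
  refine ⟨fun n z => f n z, fun n => ?_, fun n z => ?_, fun n z => by simp, h⟩
  · have := hf n
    fun_prop
  · rw [Complex.norm_real, Real.norm_eq_abs, abs_of_nonneg (hf1 n z).1]
    exact (hf1 n z).2

theorem spectralProj_inter {ω δ : Set ℂ} (hω : MeasurableSet ω) (hδ : MeasurableSet δ) :
    spectralProj S (ω ∩ δ) = spectralProj S ω * spectralProj S δ := by
  ext x
  set y := spectralProj S δ x with hy
  obtain ⟨f, hfc, hf1, -, hf⟩ := exists_approx (spectralMeasure S x + spectralMeasure S y) hω
  obtain ⟨g, hgc, hg1, -, hg⟩ := exists_approx (spectralMeasure S x + spectralMeasure S y) hδ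
  have h1 := tendsto_spectralProj S (hω.inter hδ) (x := x) (Measure.le_add_right le_rfl)
    (fun n => (hfc n).mul (hgc n)) (tendsto_eLpNorm_indicator_mul hfc hgc hω hδ hg1 hf hg)
  have h2 := tendsto_spectralProj S hω (x := y) (Measure.le_add_left le_rfl) hfc hf
  have h3 := tendsto_spectralProj S hδ (x := x) (Measure.le_add_right le_rfl) hgc hg
  refine tendsto_nhds_unique h1 ?_
  rw [mul_apply_eq_comp, ← hy]
  -- The contractions f_n(S) send the null sequence g_n(S)x − y to a null sequence, so f_n(S)
  -- g_n(S)x and f_n(S)y have the same limit.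
  have h4 : Tendsto (fun n => cfc (f n) S (cfc (g n) S x - y)) atTop (𝓝 0) := by
    refine squeeze_zero_norm (fun n => ?_) (tendsto_iff_norm_sub_tendsto_zero.1 h3)
    exact (ContinuousLinearMap.le_of_opNorm_le _ (norm_cfc_le_one S (hf1 n)) _).trans
      (one_mul _).le
  have h5 := h4.add h2
  rw [zero_add] at h5
  refine h5.congr fun n => ?_
  rw [map_sub, sub_add_cancel]
  have := cfc_mul (a := S) (f n) (g n) (hfc n).continuousOn (hgc n).continuousOn
  exact (congrArg (fun A : H →L[ℂ] H => A x) this).symm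

theorem isIdempotentElem_spectralProj {ω : Set ℂ} (hω : MeasurableSet ω) :
    IsIdempotentElem (spectralProj S ω) := by
  rw [IsIdempotentElem, ← spectralProj_inter S hω hω, Set.inter_self]

theorem isSelfAdjoint_spectralProj {ω : Set ℂ} (hω : MeasurableSet ω) :
    IsSelfAdjoint (spectralProj S ω) := by
  rw [ContinuousLinearMap.isSelfAdjoint_iff_isSymmetric]
  intro x y
  obtain ⟨f, hfc, -, hfr, hf⟩ := exists_approx (spectralMeasure S x + spectralMeasure S y) hω
  have h1 := tendsto_spectralProj S hω (x := x) (Measure.le_add_right le_rfl) hfc hf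
  have h2 := tendsto_spectralProj S hω (x := y) (Measure.le_add_left le_rfl) hfc hf
  refine tendsto_nhds_unique (h1.inner tendsto_const_nhds)
    ((tendsto_const_nhds.inner h2).congr fun n => ?_)
  have hsa : ContinuousLinearMap.adjoint (cfc (f n) S) = cfc (f n) S := by
    rw [← ContinuousLinearMap.star_eq_adjoint, ← cfc_star]
    simp only [hfr]
  rw [← ContinuousLinearMap.adjoint_inner_left, hsa]

theorem spectralProj_union {ω δ : Set ℂ} (hω : MeasurableSet ω) (hδ : MeasurableSet δ)
    (hd : Disjoint ω δ) :
    spectralProj S (ω ∪ δ) = spectralProj S ω + spectralProj S δ := by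
  ext x
  obtain ⟨f, hfc, hf1, -, hf⟩ := exists_approx (spectralMeasure S x) hω
  obtain ⟨g, hgc, hg1, -, hg⟩ := exists_approx (spectralMeasure S x) hδ
  have h1 := tendsto_spectralProj S hω (x := x) le_rfl hfc hf
  have h2 := tendsto_spectralProj S hδ (x := x) le_rfl hgc hg
  have hfg : Tendsto (fun n => eLpNorm (f n + g n - (ω ∪ δ).indicator 1) 2 (spectralMeasure S x))
      atTop (𝓝 0) := by
    have hsum := hf.add hg
    rw [add_zero] at hsum
    refine tendsto_of_tendsto_of_tendsto_of_le_of_le tendsto_const_nhds hsum (fun _ => zero_le)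
      fun n => ?_
    have heq : f n + g n - (ω ∪ δ).indicator 1
        = (f n - ω.indicator 1) + (g n - δ.indicator 1) := by
      rw [Set.indicator_union_of_disjoint hd]
      exact add_sub_add_comm _ _ _ _
    rw [heq]
    exact eLpNorm_add_le
      ((hfc n).measurable.sub (measurable_one.indicator hω)).aestronglyMeasurable
      ((hgc n).measurable.sub (measurable_one.indicator hδ)).aestronglyMeasurable (by norm_num)
  have h3 := tendsto_spectralProj S (hω.union hδ) (x := x) le_rfl
    (fun n => (hfc n).add (hgc n)) hfg
  refine tendsto_nhds_unique h3 ((h1.add h2).congr fun n => ?_)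
  have := cfc_add (a := S) (f n) (g n) (hfc n).continuousOn (hgc n).continuousOn
  exact (congrArg (fun A : H →L[ℂ] H => A x) this).symm

theorem commute_spectralProj_cfc {ω : Set ℂ} (hω : MeasurableSet ω) {g : ℂ → ℂ} :
    Commute (spectralProj S ω) (cfc g S) := by
  ext x
  obtain ⟨f, hfc, -, -, hf⟩ :=
    exists_approx (spectralMeasure S x + spectralMeasure S (cfc g S x)) hω
  have h1 := tendsto_spectralProj S hω (x := x) (Measure.le_add_right le_rfl) hfc hf
  have h2 := tendsto_spectralProj S hω (x := cfc g S x) (Measure.le_add_left le_rfl) hfc hf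
  refine tendsto_nhds_unique h2 ((((cfc g S).continuous.tendsto _).comp h1).congr fun n => ?_)
  have := (cfc_commute_cfc (f n) g S).eq
  exact (congrArg (fun A : H →L[ℂ] H => A x) this).symm

theorem commute_spectralProj {ω : Set ℂ} (hω : MeasurableSet ω) :
    Commute (spectralProj S ω) S := by
  have := commute_spectralProj_cfc S hω (g := id)
  rwa [cfc_id ℂ S] at this

theorem spectralProj_compl {ω : Set ℂ} (hω : MeasurableSet ω) :
    spectralProj S ωᶜ = 1 - spectralProj S ω := by
  rw [← spectralProj_univ S, ← Set.union_compl_self ω,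
    spectralProj_union S hω hω.compl disjoint_compl_right]
  abel

theorem spectralProj_spectrum : spectralProj S (spectrum ℂ S) = 1 := by
  have hm : MeasurableSet (spectrum ℂ S) := (spectrum.isClosed (𝕜 := ℂ) S).measurableSet
  have h : spectralProj S (spectrum ℂ S)ᶜ = 0 := by
    ext x
    rw [zero_apply, spectralProj_eq_zero_iff S hm.compl]
    exact ae_mem_spectrum S x
  rw [spectralProj_compl S hm, sub_eq_zero] at h
  exact h.symm

theorem ae_mem_of_spectralProj {ω : Set ℂ} (hω : MeasurableSet ω) (x : H) :
    ∀ᵐ z ∂spectralMeasure S (spectralProj S ω x), z ∈ ω := by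
  change spectralMeasure S (spectralProj S ω x) ωᶜ = 0
  rw [← spectralProj_eq_zero_iff S hω.compl, spectralProj_compl S hω, sub_apply, one_apply_eq_self,
    ← mul_apply_eq_comp, (isIdempotentElem_spectralProj S hω).eq, sub_self]

/-- If a continuous `g` is bounded by `C` on `ω ∩ σ(S)` then `g(S)` is bounded by `C` on the range
of the spectral projection of `ω`. -/
theorem norm_cfc_spectralProj_le {ω : Set ℂ} (hω : MeasurableSet ω) {g : ℂ → ℂ}
    (hg : Continuous g) {C : ℝ} (hC : 0 ≤ C) (h : ∀ z ∈ ω ∩ spectrum ℂ S, ‖g z‖ ≤ C) (x : H) :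
    ‖cfc g S (spectralProj S ω x)‖ ≤ C * ‖spectralProj S ω x‖ := by
  set y := spectralProj S ω x with hy
  have h1 : ‖cfc g S y‖ₑ ≤ ENNReal.ofReal C * ‖y‖ₑ := by
    have h2 := enorm_cfc_apply S (g := 1) continuous_one y
    rw [cfc_one (R := ℂ) S, one_apply_eq_self] at h2
    rw [enorm_cfc_apply S hg, h2]
    refine eLpNorm_le_mul_eLpNorm_of_ae_le_mul ?_ 2
    filter_upwards [ae_mem_spectrum S y, ae_mem_of_spectralProj S hω x] with z hz hz'
    simpa using h z ⟨hz', hz⟩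
  rwa [← ofReal_norm, ← ofReal_norm, ← ENNReal.ofReal_mul hC,
    ENNReal.ofReal_le_ofReal_iff (by positivity)] at h1

theorem spectralProj_biUnion {ι : Type*} (F : Finset ι) {ω : ι → Set ℂ}
    (hω : ∀ i, MeasurableSet (ω i)) (hd : Pairwise (Function.onFun Disjoint ω)) :
    spectralProj S (⋃ i ∈ F, ω i) = ∑ i ∈ F, spectralProj S (ω i) := by
  classical
  induction F using Finset.induction_on with
  | empty =>
    have := spectralProj_compl S MeasurableSet.univ
    simpa [spectralProj_univ] using this
  | insert a F ha ih =>
    rw [Finset.set_biUnion_insert, spectralProj_union S (hω a)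
      (Finset.measurableSet_biUnion _ fun i _ => hω i), ih, Finset.sum_insert ha]
    rw [Set.disjoint_iUnion₂_right]
    intro i hi
    exact hd fun h => ha (h ▸ hi)

/-- The error of a finite partial sum is, up to sign, the projection of the remaining union applied
to x. Its squared norm is the measure of that remainder, which tends to 0 by continuity from above.
-/
theorem hasSum_spectralProj {ω : ℕ → Set ℂ} (hω : ∀ i, MeasurableSet (ω i))
    (hd : Pairwise (Function.onFun Disjoint ω)) (x : H) :
    HasSum (fun i => spectralProj S (ω i) x) (spectralProj S (⋃ i, ω i) x) := by
  have hm : MeasurableSet (⋃ i, ω i) := MeasurableSet.iUnion hω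
  have hF : ∀ F : Finset ℕ, MeasurableSet (⋃ i ∈ F, ω i) := fun F =>
    Finset.measurableSet_biUnion _ fun i _ => hω i
  have hsub : ∀ F : Finset ℕ, (⋃ i ∈ F, ω i) ⊆ ⋃ i, ω i := fun F =>
    Set.iUnion₂_subset fun i _ => Set.subset_iUnion ω i
  have hdiff : ∀ F : Finset ℕ, ‖∑ i ∈ F, spectralProj S (ω i) x - spectralProj S (⋃ i, ω i) x‖ₑ ^ 2
      = spectralMeasure S x ((⋃ i, ω i) \ ⋃ i ∈ F, ω i) := by
    intro F
    rw [← enorm_spectralProj_sq S (hm.diff (hF F)), ← enorm_neg, neg_sub]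
    congr 2
    rw [sub_eq_iff_eq_add, ← sum_apply, ← spectralProj_biUnion S F hω hd, ← add_apply,
      ← spectralProj_union S (hm.diff (hF F)) (hF F) Set.disjoint_sdiff_left,
      Set.sdiff_union_of_subset (hsub F)]
  have hlim : Tendsto (fun F : Finset ℕ => spectralMeasure S x ((⋃ i, ω i) \ ⋃ i ∈ F, ω i))
      atTop (𝓝 0) := by
    have hanti : Antitone fun F : Finset ℕ => (⋃ i, ω i) \ ⋃ i ∈ F, ω i := by
      intro F G hFG
      exact Set.sdiff_subset_sdiff_right (Set.biUnion_subset_biUnion_left hFG)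
    have := tendsto_measure_iInter_atTop (μ := spectralMeasure S x)
      (fun F => (hm.diff (hF F)).nullMeasurableSet) hanti ⟨∅, measure_ne_top _ _⟩
    have hempty : (⋂ F : Finset ℕ, (⋃ i, ω i) \ ⋃ i ∈ F, ω i) = ∅ := by
      refine Set.eq_empty_iff_forall_notMem.2 fun z hz => ?_
      rw [Set.mem_iInter] at hz
      obtain ⟨i, hi⟩ := Set.mem_iUnion.1 (hz ∅).1
      exact (hz {i}).2 (by simpa using hi)
    rwa [hempty, measure_empty] at this
  rw [HasSum]
  have hlim2 : Tendsto (fun F : Finset ℕ =>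
      ‖∑ i ∈ F, spectralProj S (ω i) x - spectralProj S (⋃ i, ω i) x‖ₑ ^ 2) atTop (𝓝 0) := by
    simpa only [hdiff] using hlim
  have hlim3 := (ENNReal.continuous_rpow_const (y := ((2 : ℕ) : ℝ)⁻¹)).tendsto 0 |>.comp hlim2
  rw [ENNReal.zero_rpow_of_pos (by norm_num)] at hlim3
  rw [tendsto_iff_edist_tendsto_0]
  refine hlim3.congr fun F => ?_
  rw [edist_eq_enorm_sub]
  exact ENNReal.pow_rpow_inv_natCast two_ne_zero _

end SpectralProjection

end SpectralProjections

/-! ### Operators similar to a normal operator are scalar -/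

section Scalar

variable {H : Type*} [NormedAddCommGroup H] [InnerProductSpace ℂ H]

/-- R has to invert c − T only on the range of P; commuting with P lets it restrict to that range.
-/
theorem notMem_spectrum_restrict {P T R : H →L[ℂ] H} (hPT : Commute P T) (hPR : Commute P R)
    {c : ℂ} (h1 : R * (algebraMap ℂ (H →L[ℂ] H) c - T) * P = P)
    (h2 : (algebraMap ℂ (H →L[ℂ] H) c - T) * R * P = P) :
    c ∉ spectrum ℂ (T.restrict (mapsTo_range_of_commute hPT) : P.range →L[ℂ] P.range) := by
  rw [spectrum.notMem_iff]
  refine ⟨⟨_, (R.restrict (mapsTo_range_of_commute hPR) : P.range →L[ℂ] P.range), ?_, ?_⟩, rfl⟩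
  · ext ⟨_, y, rfl⟩
    have := congrArg (fun A : H →L[ℂ] H => A y) h2
    simpa [Algebra.algebraMap_eq_smul_one] using this
  · ext ⟨_, y, rfl⟩
    have := congrArg (fun A : H →L[ℂ] H => A y) h1
    simpa [Algebra.algebraMap_eq_smul_one] using this

theorem norm_sum_sq_of_orthogonal {ι : Type*} (F : Finset ι) (w : ι → H)
    (h : ∀ i j, i ≠ j → inner ℂ (w i) (w j) = 0) : ‖∑ i ∈ F, w i‖ ^ 2 = ∑ i ∈ F, ‖w i‖ ^ 2 := by
  have : ((‖∑ i ∈ F, w i‖ ^ 2 : ℝ) : ℂ) = ((∑ i ∈ F, ‖w i‖ ^ 2 : ℝ) : ℂ) := by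
    push_cast
    have h0 := inner_self_eq_norm_sq_to_K (𝕜 := ℂ) (∑ i ∈ F, w i)
    rw [sum_inner] at h0
    refine h0.symm.trans (Finset.sum_congr rfl fun i hi => ?_)
    rw [inner_sum, Finset.sum_eq_single_of_mem i hi fun j _ hj => h i j hj.symm]
    exact inner_self_eq_norm_sq_to_K (w i)
  exact_mod_cast this

/-- Take the nearest among the first points of a dense sequence. Finitely many ε-balls about these
points cover K, so the approximation is uniform once all their centres are available. -/
theorem exists_simpleFunc_tendstoUniformlyOn {K : Set ℂ} (hK : IsCompact K) :
    ∃ s : ℕ → SimpleFunc ℂ ℂ, TendstoUniformlyOn (fun n z => s n z) (fun z => z) atTop K := by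
  refine ⟨fun n => SimpleFunc.nearestPt (TopologicalSpace.denseSeq ℂ) n, ?_⟩
  rw [Metric.tendstoUniformlyOn_iff]
  intro ε hε
  obtain ⟨t, ht⟩ := hK.elim_finite_subcover
    (fun k : ℕ => Metric.ball (TopologicalSpace.denseSeq ℂ k) ε) (fun k => Metric.isOpen_ball)
    (fun z _ => by
      obtain ⟨k, hk⟩ := (TopologicalSpace.denseRange_denseSeq ℂ).exists_dist_lt z hε
      exact Set.mem_iUnion.2 ⟨k, hk⟩)
  filter_upwards [eventually_ge_atTop (t.sup id)] with n hn z hz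
  obtain ⟨k, hk, hzk⟩ := Set.mem_iUnion₂.1 (ht hz)
  have h1 := SimpleFunc.edist_nearestPt_le (TopologicalSpace.denseSeq ℂ) z
    ((Finset.le_sup (f := id) hk).trans hn)
  rw [edist_dist, edist_dist, ENNReal.ofReal_le_ofReal_iff dist_nonneg] at h1
  rw [Metric.mem_ball, dist_comm] at hzk
  rw [dist_comm]
  exact h1.trans_lt hzk

variable [CompleteSpace H]

section Resolution

variable (S : H →L[ℂ] H) [hS : IsStarNormal S]

theorem exists_resolvent_on_range {ω : Set ℂ} (hω : MeasurableSet ω) {c : ℂ} (hc : c ∉ closure ω) :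
    ∃ R : H →L[ℂ] H, Commute (spectralProj S ω) R ∧
      R * (algebraMap ℂ (H →L[ℂ] H) c - S) * spectralProj S ω = spectralProj S ω ∧
      (algebraMap ℂ (H →L[ℂ] H) c - S) * R * spectralProj S ω = spectralProj S ω := by
  obtain ⟨d, hd, hball⟩ := Metric.isOpen_iff.1 isClosed_closure.isOpen_compl c hc
  have hfar : ∀ z ∈ ω, d ≤ ‖c - z‖ := by
    intro z hz
    by_contra! hlt
    refine hball (?_ : z ∈ Metric.ball c d) (subset_closure hz)
    rwa [Metric.mem_ball, dist_comm, dist_eq_norm]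
  -- A continuous function on all of ℂ that equals 1/(c − z) wherever ‖c − z‖ ≥ d, in particular on
  -- ω.
  let h : ℂ → ℂ := fun z => star (c - z) / ((max (‖c - z‖ ^ 2) (d ^ 2) : ℝ) : ℂ)
  have hh : Continuous h := by
    refine Continuous.div (by fun_prop) (by fun_prop) fun z => ?_
    exact_mod_cast (lt_max_of_lt_right (by positivity)).ne'
  have hsub : cfc (fun z => c - z) S = algebraMap ℂ (H →L[ℂ] H) c - S := by
    rw [cfc_sub (a := S) (fun _ => c) (fun z => z), cfc_const c S, cfc_id' ℂ S]
  have hk : cfc (fun z => h z * (c - z)) S = cfc h S * (algebraMap ℂ (H →L[ℂ] H) c - S) := by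
    rw [← hsub]
    exact cfc_mul (a := S) h (fun z => c - z) hh.continuousOn (by fun_prop)
  have hcomm : cfc h S * (algebraMap ℂ (H →L[ℂ] H) c - S)
      = (algebraMap ℂ (H →L[ℂ] H) c - S) * cfc h S := by
    rw [← hsub]
    exact (cfc_commute_cfc h (fun z => c - z) S).eq
  have key : cfc h S * (algebraMap ℂ (H →L[ℂ] H) c - S) * spectralProj S ω
      = spectralProj S ω := by
    rw [← hk, ← sub_eq_zero]
    have h1 : cfc (fun z => h z * (c - z) - 1) S = cfc (fun z => h z * (c - z)) S - 1 := by
      rw [cfc_sub (a := S) (fun z => h z * (c - z)) (fun _ => 1) (by fun_prop) (by fun_prop)]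
      congr 1
      exact cfc_one ℂ S
    have h2 : (cfc (fun z => h z * (c - z)) S - 1) * spectralProj S ω = 0 := by
      rw [← h1]
      ext x
      -- The bound is used with constant 0, since h(z)(c − z) − 1 vanishes on ω.
      have := norm_cfc_spectralProj_le S hω (g := fun z => h z * (c - z) - 1) (by fun_prop) le_rfl
        (fun z hz => ?_) x
      · rw [zero_mul] at this
        exact norm_le_zero_iff.1 this
      · have hz' := hfar z hz.1
        have hne : c - z ≠ 0 := norm_pos_iff.1 (hd.trans_le hz')
        have hmax : max (‖c - z‖ ^ 2) (d ^ 2) = ‖c - z‖ ^ 2 :=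
          max_eq_left (pow_le_pow_left₀ hd.le hz' 2)
        simp only [h, hmax]
        rw [div_mul_eq_mul_div, mul_comm, RCLike.star_def, Complex.mul_conj,
          Complex.normSq_eq_norm_sq, div_self, sub_self, norm_zero]
        exact_mod_cast (by positivity)
    rwa [sub_mul, one_mul] at h2
  exact ⟨cfc h S, commute_spectralProj_cfc S hω, key, by rw [← hcomm, key]⟩

/-- On each piece S is within ε of the scalar c. The pieces are mutually orthogonal and reduce S, so
Pythagoras sums the errors without losing a factor for their number. -/
theorem norm_simpleIntegral_sub_le (s : SimpleFunc ℂ ℂ) {ε : ℝ} (hε : 0 ≤ ε)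
    (h : ∀ z ∈ spectrum ℂ S, ‖z - s z‖ ≤ ε) :
    ‖simpleIntegral (spectralProj S) (spectrum ℂ S) s - S‖ ≤ ε := by
  have hK : MeasurableSet (spectrum ℂ S) := (spectrum.isClosed (𝕜 := ℂ) S).measurableSet
  set ω : ℂ → Set ℂ := fun c => s ⁻¹' {c} ∩ spectrum ℂ S with hω
  have hm : ∀ c, MeasurableSet (ω c) := fun c => (s.measurableSet_fiber c).inter hK
  have hd : Pairwise (Function.onFun Disjoint ω) := by
    intro c d hcd
    rw [Function.onFun, Set.disjoint_left]
    rintro z ⟨hz, -⟩ ⟨hz', -⟩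
    exact hcd (hz.symm.trans hz')
  have hunion : ⋃ c ∈ s.range, ω c = spectrum ℂ S := by
    ext z
    simp [hω]
  have hsum : ∑ c ∈ s.range, spectralProj S (ω c) = 1 := by
    rw [← spectralProj_biUnion S s.range hm hd, hunion, spectralProj_spectrum]
  have horth : ∀ c d x y, c ≠ d →
      inner ℂ (spectralProj S (ω c) x) (spectralProj S (ω d) y) = 0 := by
    intro c d x y hcd
    have h0 : spectralProj S (ω c) * spectralProj S (ω d) = 0 := by
      have he := spectralProj_compl S MeasurableSet.univ
      rw [Set.compl_univ, spectralProj_univ, sub_self] at he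
      rw [← spectralProj_inter S (hm c) (hm d), (hd hcd).inter_eq, he]
    rw [(ContinuousLinearMap.isSelfAdjoint_iff_isSymmetric.1
      (isSelfAdjoint_spectralProj S (hm c))).apply_clm, ← mul_apply_eq_comp, h0, zero_apply,
      inner_zero_right]
  refine ContinuousLinearMap.opNorm_le_bound _ hε fun x => ?_
  set w : ℂ → H := fun c => cfc (fun z => z - c) S (spectralProj S (ω c) x) with hw
  have hw1 : ∀ c, w c = spectralProj S (ω c) (cfc (fun z => z - c) S x) := fun c =>
    congrArg (fun A : H →L[ℂ] H => A x) (commute_spectralProj_cfc S (hm c)).eq.symm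
  have hw2 : ∀ c, ‖w c‖ ≤ ε * ‖spectralProj S (ω c) x‖ := by
    refine fun c => norm_cfc_spectralProj_le S (hm c) (by fun_prop) hε ?_ x
    rintro z ⟨⟨hz, hz'⟩, -⟩
    rw [← (show s z = c from hz)]
    exact h z hz'
  have hw3 : ∀ c, w c = S (spectralProj S (ω c) x) - c • spectralProj S (ω c) x := by
    intro c
    simp only [hw]
    rw [cfc_sub (a := S) (fun z => z) (fun _ => c), cfc_const c S, cfc_id' ℂ S]
    simp [Algebra.algebraMap_eq_smul_one]
  have hx : ∑ c ∈ s.range, spectralProj S (ω c) x = x := by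
    rw [← sum_apply, hsum, one_apply_eq_self]
  have hrep : (simpleIntegral (spectralProj S) (spectrum ℂ S) s - S) x
      = -∑ c ∈ s.range, w c := by
    have hint : simpleIntegral (spectralProj S) (spectrum ℂ S) s
        = ∑ c ∈ s.range, c • spectralProj S (ω c) := rfl
    simp only [hw3, Finset.sum_sub_distrib, ← map_sum, hx, hint, sub_apply, sum_apply,
      smul_apply, neg_sub]
  have hsq : ‖(simpleIntegral (spectralProj S) (spectrum ℂ S) s - S) x‖ ^ 2 ≤ (ε * ‖x‖) ^ 2 := by
    rw [hrep, norm_neg, norm_sum_sq_of_orthogonal _ _ fun c d hcd => by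
      rw [hw1, hw1]; exact horth c d _ _ hcd]
    calc ∑ c ∈ s.range, ‖w c‖ ^ 2 ≤ ∑ c ∈ s.range, ε ^ 2 * ‖spectralProj S (ω c) x‖ ^ 2 :=
          Finset.sum_le_sum fun c _ => by
            rw [← mul_pow]; exact pow_le_pow_left₀ (norm_nonneg _) (hw2 c) 2
      _ = (ε * ‖x‖) ^ 2 := by
          rw [← Finset.mul_sum, ← norm_sum_sq_of_orthogonal _ _ fun c d hcd => horth c d _ _ hcd,
            hx, mul_pow]
  exact (pow_le_pow_iff_left₀ (norm_nonneg _) (by positivity) two_ne_zero).1 hsq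

/-- An operator similar to a normal operator is scalar. -/
theorem isScalarOperator_units_conj (G : (H →L[ℂ] H)ˣ) :
    IsScalarOperator ((G : H →L[ℂ] H) * S * (↑G⁻¹ : H →L[ℂ] H)) := by
  set E : Set ℂ → H →L[ℂ] H := fun ω => G * spectralProj S ω * (↑G⁻¹ : H →L[ℂ] H) with hE
  have hconj : ∀ A B : H →L[ℂ] H, (G * A * (↑G⁻¹ : H →L[ℂ] H) : H →L[ℂ] H)
      * (G * B * (↑G⁻¹ : H →L[ℂ] H)) = G * (A * B) * (↑G⁻¹ : H →L[ℂ] H) := by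
    intro A B
    simp only [mul_assoc, Units.inv_mul_cancel_left]
  have hcomm : ∀ A B : H →L[ℂ] H, Commute A B → Commute
      (G * A * (↑G⁻¹ : H →L[ℂ] H) : H →L[ℂ] H) (G * B * (↑G⁻¹ : H →L[ℂ] H)) := by
    intro A B hAB
    rw [Commute, SemiconjBy, hconj, hconj, hAB.eq]
  have halg : ∀ c : ℂ, algebraMap ℂ (H →L[ℂ] H) c - G * S * (↑G⁻¹ : H →L[ℂ] H)
      = G * (algebraMap ℂ (H →L[ℂ] H) c - S) * (↑G⁻¹ : H →L[ℂ] H) := by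
    intro c
    rw [mul_sub, sub_mul, ← Algebra.commutes, Units.mul_inv_cancel_right]
  refine ⟨E, ⟨?_, ?_, ?_, ?_, ?_, ?_, ?_⟩, ?_⟩
  · intro ω hω
    rw [IsIdempotentElem, hconj, (isIdempotentElem_spectralProj S hω).eq]
  · simp only [hE, spectralProj_univ, mul_one, Units.mul_inv]
  · intro ω δ hω hδ
    rw [hconj, ← spectralProj_inter S hω hδ]
  · intro ω hω hd x
    exact (hasSum_spectralProj S hω hd ((↑G⁻¹ : H →L[ℂ] H) x)).mapL G.val
  · refine ⟨‖G.val‖ * 1 * ‖(↑G⁻¹ : H →L[ℂ] H)‖, fun ω _ => ?_⟩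
    refine (norm_mul_le _ _).trans ?_
    gcongr
    refine (norm_mul_le _ _).trans ?_
    gcongr
    exact norm_spectralProj_le S ω
  · exact fun ω hω => hcomm _ _ (commute_spectralProj S hω)
  · intro ω hω c hc
    by_contra hcl
    obtain ⟨R, hR, h1, h2⟩ := exists_resolvent_on_range S hω hcl
    refine notMem_spectrum_restrict (R := (G : H →L[ℂ] H) * R * (↑G⁻¹ : H →L[ℂ] H))
      (hcomm _ _ (commute_spectralProj S hω)) (hcomm _ _ hR) ?_ ?_ hc
    · rw [halg, hconj, hconj, h1]
    · rw [halg, hconj, hconj, h2]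
  · rw [spectrum.units_conjugate]
    obtain ⟨s, hs⟩ := exists_simpleFunc_tendstoUniformlyOn (spectrum.isCompact (𝕜 := ℂ) S)
    refine ⟨s, hs, ?_⟩
    have hlim : Tendsto (fun n => simpleIntegral (spectralProj S) (spectrum ℂ S) (s n)) atTop
        (𝓝 S) := by
      rw [Metric.tendsto_nhds]
      intro ε hε
      filter_upwards [Metric.tendstoUniformlyOn_iff.1 hs (ε / 2) (half_pos hε)] with n hn
      rw [dist_eq_norm]
      refine (norm_simpleIntegral_sub_le S (s n) (half_pos hε).le fun z hz => ?_).trans_lt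
        (half_lt_self hε)
      rw [← dist_eq_norm]
      exact (hn z hz).le
    have heq : ∀ t : SimpleFunc ℂ ℂ, simpleIntegral E (spectrum ℂ S) t
        = G * simpleIntegral (spectralProj S) (spectrum ℂ S) t * (↑G⁻¹ : H →L[ℂ] H) := by
      intro t
      simp only [simpleIntegral, hE, Finset.mul_sum, Finset.sum_mul, mul_smul_comm, smul_mul_assoc]
    simp only [heq]
    exact (hlim.const_mul _).mul_const _

end Resolution

end Scalar

/-! ### From a bounded resolution of the identity to a positive symmetrizer -/

section Symmetrizers

variable {H : Type*} [NormedAddCommGroup H] [InnerProductSpace ℂ H]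

section Signs

/-- Signs `±1`, as complex numbers. -/
def IsSign {ι : Type*} (σ : ι → ℂ) : Prop := ∀ i, σ i = 1 ∨ σ i = -1

theorem norm_add_sq_add_norm_sub_sq (a b : H) :
    ‖a + b‖ ^ 2 + ‖a - b‖ ^ 2 = 2 * (‖a‖ ^ 2 + ‖b‖ ^ 2) := by
  have := parallelogram_law_with_norm ℂ a b
  linarith

theorem IsSign.exists_insert {ι : Type*} [DecidableEq ι] {F : Finset ι} {a : ι} (ha : a ∉ F)
    {σ : ι → ℂ} (hσ : IsSign σ) (v : ι → H) {c : ℂ} (hc : c = 1 ∨ c = -1) :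
    ∃ τ : ι → ℂ, IsSign τ ∧ ∑ i ∈ insert a F, τ i • v i = (∑ i ∈ F, σ i • v i) + c • v a := by
  refine ⟨Function.update σ a c, fun i => ?_, ?_⟩
  · rcases eq_or_ne i a with rfl | hi
    · simpa using hc
    · simpa [hi] using hσ i
  · rw [Finset.sum_insert ha, Function.update_self, add_comm]
    congr 1
    refine Finset.sum_congr rfl fun i hi => ?_
    rw [Function.update_of_ne (ne_of_mem_of_not_mem hi ha)]

/-- By the parallelogram law ‖a + b‖² and ‖a − b‖² average to ‖a‖² + ‖b‖², so one sign for each new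
vector does not fall below the sum of squares. The opposite choice gives `exists_isSign_le_sum`. -/
theorem exists_isSign_sum_le {ι : Type*} (F : Finset ι) (v : ι → H) :
    ∃ σ : ι → ℂ, IsSign σ ∧ ∑ i ∈ F, ‖v i‖ ^ 2 ≤ ‖∑ i ∈ F, σ i • v i‖ ^ 2 := by
  classical
  induction F using Finset.induction_on with
  | empty => exact ⟨fun _ => 1, fun _ => Or.inl rfl, by simp⟩
  | insert a F ha ih =>
    obtain ⟨σ, hσ, h⟩ := ih
    have hpar := norm_add_sq_add_norm_sub_sq (∑ i ∈ F, σ i • v i) (v a)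
    obtain ⟨τ, hτ, hτs⟩ := hσ.exists_insert ha v (Or.inl rfl)
    obtain ⟨υ, hυ, hυs⟩ := hσ.exists_insert ha v (Or.inr rfl)
    rw [one_smul] at hτs
    rw [neg_one_smul, ← sub_eq_add_neg] at hυs
    rw [Finset.sum_insert ha]
    rcases le_total (‖∑ i ∈ F, σ i • v i - v a‖ ^ 2) (‖∑ i ∈ F, σ i • v i + v a‖ ^ 2) with hle | hle
    · exact ⟨τ, hτ, by rw [hτs]; linarith⟩
    · exact ⟨υ, hυ, by rw [hυs]; linarith⟩

theorem exists_isSign_le_sum {ι : Type*} (F : Finset ι) (v : ι → H) :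
    ∃ σ : ι → ℂ, IsSign σ ∧ ‖∑ i ∈ F, σ i • v i‖ ^ 2 ≤ ∑ i ∈ F, ‖v i‖ ^ 2 := by
  classical
  induction F using Finset.induction_on with
  | empty => exact ⟨fun _ => 1, fun _ => Or.inl rfl, by simp⟩
  | insert a F ha ih =>
    obtain ⟨σ, hσ, h⟩ := ih
    have hpar := norm_add_sq_add_norm_sub_sq (∑ i ∈ F, σ i • v i) (v a)
    obtain ⟨τ, hτ, hτs⟩ := hσ.exists_insert ha v (Or.inl rfl)
    obtain ⟨υ, hυ, hυs⟩ := hσ.exists_insert ha v (Or.inr rfl)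
    rw [one_smul] at hτs
    rw [neg_one_smul, ← sub_eq_add_neg] at hυs
    rw [Finset.sum_insert ha]
    rcases le_total (‖∑ i ∈ F, σ i • v i - v a‖ ^ 2) (‖∑ i ∈ F, σ i • v i + v a‖ ^ 2) with hle | hle
    · exact ⟨υ, hυ, by rw [hυs]; linarith⟩
    · exact ⟨τ, hτ, by rw [hτs]; linarith⟩

variable {ι : Type*} {F : Finset ι} {P : ι → H →L[ℂ] H} {C : ℝ}

theorem sum_norm_sq_le (hC : ∀ σ : ι → ℂ, IsSign σ → ‖∑ i ∈ F, σ i • P i‖ ≤ C) (x : H) :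
    ∑ i ∈ F, ‖P i x‖ ^ 2 ≤ (C * ‖x‖) ^ 2 := by
  obtain ⟨σ, hσ, h⟩ := exists_isSign_sum_le F fun i => P i x
  refine h.trans (pow_le_pow_left₀ (norm_nonneg _) ?_ 2)
  have := ContinuousLinearMap.le_of_opNorm_le _ (hC σ hσ) x
  simpa [sum_apply] using this

/-- The signed sum U = ∑ σ_i P_i satisfies U² = ∑ P_i = 1, so ‖x‖ ≤ C ‖U x‖; the signs are chosen to
make ‖U x‖ small. -/
theorem norm_sq_le_sum (hC : ∀ σ : ι → ℂ, IsSign σ → ‖∑ i ∈ F, σ i • P i‖ ≤ C)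
    (hP : ∀ i ∈ F, P i * P i = P i) (hPQ : ∀ i ∈ F, ∀ j ∈ F, i ≠ j → P i * P j = 0)
    (h1 : ∑ i ∈ F, P i = 1) (x : H) :
    ‖x‖ ^ 2 ≤ C ^ 2 * ∑ i ∈ F, ‖P i x‖ ^ 2 := by
  obtain ⟨σ, hσ, h⟩ := exists_isSign_le_sum F fun i => P i x
  have hsq : (∑ i ∈ F, σ i • P i) * (∑ i ∈ F, σ i • P i) = 1 := by
    rw [Finset.sum_mul, ← h1]
    refine Finset.sum_congr rfl fun i hi => ?_
    rw [Finset.mul_sum, Finset.sum_eq_single_of_mem i hi fun j hj hji => by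
      rw [smul_mul_smul_comm, hPQ i hi j hj hji.symm, smul_zero], smul_mul_smul_comm, hP i hi]
    rcases hσ i with h | h <;> simp [h]
  have hx : x = (∑ i ∈ F, σ i • P i) (∑ i ∈ F, σ i • P i x) := by
    have := congrArg (fun A : H →L[ℂ] H => A x) hsq
    simpa [sum_apply] using this.symm
  calc ‖x‖ ^ 2 ≤ (C * ‖∑ i ∈ F, σ i • P i x‖) ^ 2 := by
        refine pow_le_pow_left₀ (norm_nonneg _) ?_ 2
        conv_lhs => rw [hx]
        exact ContinuousLinearMap.le_of_opNorm_le _ (hC σ hσ) _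
    _ ≤ _ := by
        rw [mul_pow]
        gcongr

end Signs

/-- Passing to a vector measure supplies finite additivity and the vanishing of E ∅. -/
theorem IsResolutionOfIdentity.exists_vectorMeasure {T : H →L[ℂ] H} {E : Set ℂ → H →L[ℂ] H}
    (hE : IsResolutionOfIdentity T E) (x : H) :
    ∃ v : VectorMeasure ℂ H, ∀ ω, MeasurableSet ω → v ω = E ω x := by
  classical
  refine ⟨⟨fun ω => if MeasurableSet ω then E ω x else 0, ?_, fun ω hω => if_neg hω, ?_⟩,
    fun ω hω => if_pos hω⟩
  · rw [if_pos MeasurableSet.empty]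
    have := hE.hasSum (fun _ => ∅) (fun _ => MeasurableSet.empty) (fun _ _ _ => disjoint_bot_left) x
    -- The constant sequence E ∅ x is summable, hence zero.
    exact tendsto_nhds_unique tendsto_const_nhds this.summable.tendsto_atTop_zero
  · intro f hf hd
    simp only [hf, MeasurableSet.iUnion hf, if_true]
    exact hE.hasSum f hf hd x

theorem IsResolutionOfIdentity.empty {T : H →L[ℂ] H} {E : Set ℂ → H →L[ℂ] H}
    (hE : IsResolutionOfIdentity T E) : E ∅ = 0 := by
  ext x
  obtain ⟨v, hv⟩ := hE.exists_vectorMeasure x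
  rw [← hv _ MeasurableSet.empty, v.empty, zero_apply]

theorem IsResolutionOfIdentity.sum_fiber {T : H →L[ℂ] H} {E : Set ℂ → H →L[ℂ] H}
    (hE : IsResolutionOfIdentity T E) (t : SimpleFunc ℂ ℂ) (A : Finset ℂ) :
    ∑ c ∈ A, E (t ⁻¹' {c}) = E (t ⁻¹' A) := by
  ext x
  obtain ⟨v, hv⟩ := hE.exists_vectorMeasure x
  have hU : t ⁻¹' (A : Set ℂ) = ⋃ c ∈ A, t ⁻¹' {c} := by
    ext z; simp
  rw [← hv _ (t.measurableSet_preimage _), hU, v.of_biUnion_finset, sum_apply]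
  · exact Finset.sum_congr rfl fun c _ => (hv _ (t.measurableSet_fiber c)).symm
  · intro c _ d _ hcd
    exact Disjoint.preimage _ (Set.disjoint_singleton.2 hcd)
  · exact fun c _ => t.measurableSet_fiber c

theorem IsResolutionOfIdentity.sum_range {T : H →L[ℂ] H} {E : Set ℂ → H →L[ℂ] H}
    (hE : IsResolutionOfIdentity T E) (t : SimpleFunc ℂ ℂ) :
    ∑ c ∈ t.range, E (t ⁻¹' {c}) = 1 := by
  rw [hE.sum_fiber, ← hE.univ]
  congr 1
  ext z
  simp

theorem IsResolutionOfIdentity.mul_fiber_of_ne {T : H →L[ℂ] H} {E : Set ℂ → H →L[ℂ] H}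
    (hE : IsResolutionOfIdentity T E) (t : SimpleFunc ℂ ℂ) {c d : ℂ} (h : c ≠ d) :
    E (t ⁻¹' {c}) * E (t ⁻¹' {d}) = 0 := by
  rw [← hE.inter _ _ (t.measurableSet_fiber c) (t.measurableSet_fiber d),
    (Disjoint.preimage _ (Set.disjoint_singleton.2 h)).inter_eq, hE.empty]

/-- Grouping by sign leaves a difference of only two projections of E, so the bound does not depend
on the number of values of t. -/
theorem IsResolutionOfIdentity.norm_sum_sign_le {T : H →L[ℂ] H} {E : Set ℂ → H →L[ℂ] H}
    (hE : IsResolutionOfIdentity T E) {M : ℝ} (hM : ∀ ω, MeasurableSet ω → ‖E ω‖ ≤ M)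
    (t : SimpleFunc ℂ ℂ) {σ : ℂ → ℂ} (hσ : IsSign σ) :
    ‖∑ c ∈ t.range, σ c • E (t ⁻¹' {c})‖ ≤ 2 * M := by
  classical
  have hsplit : ∑ c ∈ t.range, σ c • E (t ⁻¹' {c})
      = E (t ⁻¹' (t.range.filter fun c => σ c = 1 : Finset ℂ))
        - E (t ⁻¹' (t.range.filter fun c => ¬ σ c = 1 : Finset ℂ)) := by
    rw [← hE.sum_fiber, ← hE.sum_fiber, ← Finset.sum_filter_add_sum_filter_not t.range
      fun c => σ c = 1, sub_eq_add_neg, ← Finset.sum_neg_distrib]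
    congr 1
    · refine Finset.sum_congr rfl fun c hc => ?_
      rw [(Finset.mem_filter.1 hc).2, one_smul]
    · refine Finset.sum_congr rfl fun c hc => ?_
      rw [(hσ c).resolve_left (Finset.mem_filter.1 hc).2, neg_one_smul]
  rw [hsplit, two_mul]
  exact (norm_sub_le _ _).trans (add_le_add (hM _ (t.measurableSet_preimage _))
    (hM _ (t.measurableSet_preimage _)))

/-- The fibres of the restriction partition all of ℂ, so their projections sum to 1; the added piece
outside K carries the coefficient 0. -/
theorem IsResolutionOfIdentity.simpleIntegral_eq {T : H →L[ℂ] H} {E : Set ℂ → H →L[ℂ] H}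
    (hE : IsResolutionOfIdentity T E) {K : Set ℂ} (hK : MeasurableSet K) (s : SimpleFunc ℂ ℂ) :
    simpleIntegral E K s
      = ∑ c ∈ (s.restrict K).range, c • E (s.restrict K ⁻¹' {c}) := by
  classical
  have hempty : ∀ (t : SimpleFunc ℂ ℂ) {c : ℂ}, c ∉ t.range → t ⁻¹' {c} = ∅ := by
    intro t c hc
    refine Set.eq_empty_iff_forall_notMem.2 fun z hz => hc ?_
    rw [SimpleFunc.mem_range]
    exact ⟨z, hz⟩
  have h1 : simpleIntegral E K s
      = ∑ c ∈ s.range ∪ (s.restrict K).range, c • E (s ⁻¹' {c} ∩ K) := by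
    refine Finset.sum_subset Finset.subset_union_left fun c _ hc => ?_
    rw [hempty s hc, Set.empty_inter, hE.empty, smul_zero]
  have h2 : ∑ c ∈ (s.restrict K).range, c • E (s.restrict K ⁻¹' {c})
      = ∑ c ∈ s.range ∪ (s.restrict K).range, c • E (s.restrict K ⁻¹' {c}) := by
    refine Finset.sum_subset Finset.subset_union_right fun c _ hc => ?_
    rw [hempty _ hc, hE.empty, smul_zero]
  rw [h1, h2]
  refine Finset.sum_congr rfl fun c _ => ?_
  rcases eq_or_ne c 0 with rfl | hc
  · simp
  · rw [SimpleFunc.restrict_preimage_singleton s hK hc, Set.inter_comm]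

variable [CompleteSpace H]

/-- Bounded scalar sequences converge along an ultrafilter, and the limits form a bounded
sesquilinear form, which is represented by an operator. -/
theorem exists_tendsto_inner_hyperfilter {Z : ℕ → H →L[ℂ] H} {C : ℝ} (hZ : ∀ n, ‖Z n‖ ≤ C) :
    ∃ Z' : H →L[ℂ] H, ∀ x y, Tendsto (fun n => inner ℂ (Z n x) y) (hyperfilter ℕ)
      (𝓝 (inner ℂ (Z' x) y)) := by
  have hb : ∀ x y n, ‖inner ℂ (Z n x) y‖ ≤ C * ‖x‖ * ‖y‖ := fun x y n =>
    (norm_inner_le_norm _ _).trans (by gcongr; exact ContinuousLinearMap.le_of_opNorm_le _ (hZ n) x)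
  have hlim : ∀ x y, ∃ a : ℂ, Tendsto (fun n => inner ℂ (Z n x) y) (hyperfilter ℕ) (𝓝 a) := by
    intro x y
    obtain ⟨a, -, ha⟩ := (isCompact_closedBall (0 : ℂ) (C * ‖x‖ * ‖y‖)).ultrafilter_le_nhds
      ((hyperfilter ℕ).map fun n => inner ℂ (Z n x) y)
      (by
        rw [Ultrafilter.coe_map, le_principal_iff]
        change ∀ᶠ n in hyperfilter ℕ, inner ℂ (Z n x) y ∈ Metric.closedBall (0 : ℂ) (C * ‖x‖ * ‖y‖)
        exact Filter.Eventually.of_forall fun n => by simpa using hb x y n)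
    exact ⟨a, ha⟩
  choose L hL using hlim
  let B : H →ₗ⋆[ℂ] H →ₗ[ℂ] ℂ := LinearMap.mk₂'ₛₗ (starRingEnd ℂ) (RingHom.id ℂ) L
    (fun x x' y => tendsto_nhds_unique (hL _ _) (((hL x y).add (hL x' y)).congr fun n => by
      rw [map_add, inner_add_left]))
    (fun c x y => tendsto_nhds_unique (hL _ _) (((hL x y).const_mul (starRingEnd ℂ c)).congr
      fun n => by rw [map_smul, inner_smul_left]))
    (fun x y y' => tendsto_nhds_unique (hL _ _) (((hL x y).add (hL x y')).congr fun n => by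
      rw [inner_add_right]))
    (fun c x y => tendsto_nhds_unique (hL _ _) (((hL x y).const_mul c).congr
      fun n => by rw [inner_smul_right]))
  have hB : ∀ x y, ‖B x y‖ ≤ C * ‖x‖ * ‖y‖ := fun x y =>
    le_of_tendsto (hL x y).norm (Filter.Eventually.of_forall fun n => hb x y n)
  refine ⟨InnerProductSpace.continuousLinearMapOfBilin (B.mkContinuous₂ _ hB), fun x y => ?_⟩
  rw [InnerProductSpace.continuousLinearMapOfBilin_apply]
  exact hL x y

section Gram

variable {ι : Type*} (F : Finset ι) (P : ι → H →L[ℂ] H)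

/-- The operator `∑ i, (P i)† ∘ P i`. -/
noncomputable def gram : H →L[ℂ] H := ∑ i ∈ F, ContinuousLinearMap.adjoint (P i) * P i

theorem inner_gram (x y : H) : inner ℂ (gram F P x) y = ∑ i ∈ F, inner ℂ (P i x) (P i y) := by
  simp [gram, sum_apply, ContinuousLinearMap.adjoint_inner_left]

/-- Apply Cauchy–Schwarz to the form at x and y = `gram F P x`, then cancel one factor ‖y‖. -/
theorem norm_gram_le {C : ℝ} (hC0 : 0 ≤ C) (hC : ∀ x, ∑ i ∈ F, ‖P i x‖ ^ 2 ≤ (C * ‖x‖) ^ 2) :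
    ‖gram F P‖ ≤ C ^ 2 := by
  refine ContinuousLinearMap.opNorm_le_bound _ (sq_nonneg C) fun x => ?_
  have hs : ∀ y, √(∑ i ∈ F, ‖P i y‖ ^ 2) ≤ C * ‖y‖ := fun y =>
    Real.sqrt_le_iff.2 ⟨by positivity, hC y⟩
  have h : ‖gram F P x‖ ^ 2 ≤ C ^ 2 * ‖x‖ * ‖gram F P x‖ := by
    set y := gram F P x with hy
    calc ‖y‖ ^ 2 = ‖inner ℂ (gram F P x) y‖ := by
          rw [← hy, inner_self_eq_norm_sq_to_K]; simp
      _ ≤ ∑ i ∈ F, ‖P i x‖ * ‖P i y‖ := by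
          rw [inner_gram]
          exact (norm_sum_le _ _).trans (Finset.sum_le_sum fun i _ => norm_inner_le_norm _ _)
      _ ≤ √(∑ i ∈ F, ‖P i x‖ ^ 2) * √(∑ i ∈ F, ‖P i y‖ ^ 2) :=
          Real.sum_mul_le_sqrt_mul_sqrt _ _ _
      _ ≤ (C * ‖x‖) * (C * ‖y‖) := by
          gcongr
          · exact hs x
          · exact hs y
      _ = _ := by ring
  rcases (norm_nonneg (gram F P x)).eq_or_lt with h0 | h0
  · rw [← h0]; positivity
  · rw [sq] at h
    exact le_of_mul_le_mul_right h h0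

theorem inner_gram_self (x : H) : inner ℂ (gram F P x) x = ((∑ i ∈ F, ‖P i x‖ ^ 2 : ℝ) : ℂ) := by
  rw [inner_gram]
  push_cast
  exact Finset.sum_congr rfl fun i _ => inner_self_eq_norm_sq_to_K _

/-- Since P_i (∑ a_j P_j) = a_i P_i, the form is diagonal; the conjugates come from conjugate
linearity in the first slot. -/
theorem inner_gram_sum_smul (hP : ∀ i ∈ F, P i * P i = P i)
    (hPQ : ∀ i ∈ F, ∀ j ∈ F, i ≠ j → P i * P j = 0) (a : ι → ℂ) (x : H) :
    inner ℂ (gram F P ((∑ i ∈ F, a i • P i) x)) x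
      = ∑ i ∈ F, star (a i) * ((‖P i x‖ ^ 2 : ℝ) : ℂ) := by
  rw [inner_gram]
  refine Finset.sum_congr rfl fun i hi => ?_
  have h : P i * ∑ j ∈ F, a j • P j = a i • P i := by
    rw [Finset.mul_sum, Finset.sum_eq_single_of_mem i hi fun j hj hji => by
      rw [mul_smul_comm, hPQ i hi j hj hji.symm, smul_zero], mul_smul_comm, hP i hi]
  have h' : P i ((∑ j ∈ F, a j • P j) x) = a i • P i x :=
    congrArg (fun A : H →L[ℂ] H => A x) h
  rw [h', inner_smul_left, inner_self_eq_norm_sq_to_K]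
  push_cast
  rfl

end Gram

/-- A scalar operator with nonnegative spectrum is positive for an equivalent inner product. -/
theorem IsScalarOperator.exists_isPositive_mul {T : H →L[ℂ] H} (hT : IsScalarOperator T)
    (hσ : SpectrumNonneg T) :
    ∃ Z : H →L[ℂ] H, IsUnit Z ∧ Z.IsPositive ∧ (Z * T).IsPositive := by
  obtain ⟨E, hE, s, hs, hlim⟩ := hT
  obtain ⟨M, hM⟩ := hE.bounded
  have hK : MeasurableSet (spectrum ℂ T) := (spectrum.isClosed (𝕜 := ℂ) T).measurableSet
  -- The maximum with 1 makes C positive, as needed for the lower bound C⁻².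
  set C : ℝ := 2 * max M 1 with hCdef
  have hCpos : 0 < C := mul_pos two_pos (lt_max_of_lt_right one_pos)
  set t : ℕ → SimpleFunc ℂ ℂ := fun n => (s n).restrict (spectrum ℂ T) with ht
  set P : ℕ → ℂ → H →L[ℂ] H := fun n c => E (t n ⁻¹' {c}) with hPdef
  have hC : ∀ n, ∀ σ : ℂ → ℂ, IsSign σ → ‖∑ c ∈ (t n).range, σ c • P n c‖ ≤ C := fun n σ hσ =>
    hE.norm_sum_sign_le (fun ω hω => (hM ω hω).trans (le_max_left _ _)) (t n) hσ
  have hP : ∀ n, ∀ c ∈ (t n).range, P n c * P n c = P n c := fun n c _ =>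
    hE.idempotent _ ((t n).measurableSet_fiber c)
  have hPQ : ∀ n, ∀ c ∈ (t n).range, ∀ d ∈ (t n).range, c ≠ d → P n c * P n d = 0 :=
    fun n c _ d _ h => hE.mul_fiber_of_ne (t n) h
  have hsum : ∀ n, ∑ c ∈ (t n).range, P n c = 1 := fun n => hE.sum_range (t n)
  have hup : ∀ n x, ∑ c ∈ (t n).range, ‖P n c x‖ ^ 2 ≤ (C * ‖x‖) ^ 2 := fun n =>
    sum_norm_sq_le (hC n)
  have hlow : ∀ n x, ‖x‖ ^ 2 ≤ C ^ 2 * ∑ c ∈ (t n).range, ‖P n c x‖ ^ 2 := fun n =>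
    norm_sq_le_sum (hC n) (hP n) (hPQ n) (hsum n)
  set Z : ℕ → H →L[ℂ] H := fun n => gram (t n).range (P n) with hZdef
  have hZ : ∀ n, ‖Z n‖ ≤ C ^ 2 := fun n => norm_gram_le _ _ hCpos.le (hup n)
  obtain ⟨Z', hZ'⟩ := exists_tendsto_inner_hyperfilter hZ
  set Tn : ℕ → H →L[ℂ] H := fun n => ∑ c ∈ (t n).range, c • P n c with hTn
  have hTlim : Tendsto Tn atTop (𝓝 T) :=
    hlim.congr fun n => hE.simpleIntegral_eq hK (s n)
  -- The nonnegative reals are closed in ℂ, so positivity of quadratic forms survives the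
  -- ultrafilter limit.
  have hclosed : IsClosed {z : ℂ | (z.re : ℂ) = z ∧ 0 ≤ z.re} :=
    (isClosed_eq (Complex.continuous_ofReal.comp Complex.continuous_re) continuous_id).inter
      (isClosed_le continuous_const Complex.continuous_re)
  have hself : ∀ x, Tendsto (fun n => ((∑ c ∈ (t n).range, ‖P n c x‖ ^ 2 : ℝ) : ℂ))
      (hyperfilter ℕ) (𝓝 (inner ℂ (Z' x) x)) := fun x =>
    (hZ' x x).congr fun n => inner_gram_self _ _ x
  have hpos : ∀ x, ((inner ℂ (Z' x) x).re : ℂ) = inner ℂ (Z' x) x ∧ 0 ≤ (inner ℂ (Z' x) x).re :=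
    fun x => hclosed.mem_of_tendsto (hself x) <| Filter.Eventually.of_forall fun n =>
      ⟨by rw [Complex.ofReal_re], by rw [Complex.ofReal_re]; positivity⟩
  refine ⟨Z', ?_, (ContinuousLinearMap.isPositive_iff_complex _).2 hpos,
    (ContinuousLinearMap.isPositive_iff_complex _).2 fun x => ?_⟩
  -- The uniform bound ⟪Z_n x, x⟫ ≥ C⁻² ‖x‖² passes to the limit and gives invertibility.
  · refine ContinuousLinearMap.isUnit_of_forall_le_norm_inner_map Z'
      (c := (C.toNNReal ^ 2)⁻¹) (by positivity) fun x => ?_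
    refine ge_of_tendsto (hself x).norm (Filter.Eventually.of_forall fun n => ?_)
    rw [Complex.norm_real, Real.norm_of_nonneg (by positivity), NNReal.coe_inv, NNReal.coe_pow,
      Real.coe_toNNReal _ hCpos.le, mul_inv_le_iff₀ (by positivity), mul_comm]
    exact hlow n x
  -- The form of Z_n T_n is ∑ c̄ ‖P_c x‖². Each value c is 0 or close to a point of [0, ∞), so c̄
  -- may be replaced by ‖c‖, which makes the form nonnegative.
  · have hρ : Tendsto (fun n => inner ℂ (Z n (Tn n x)) x
        - ((∑ c ∈ (t n).range, ‖c‖ * ‖P n c x‖ ^ 2 : ℝ) : ℂ)) atTop (𝓝 0) := by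
      rw [Metric.tendsto_nhds]
      intro ε hε
      -- Chosen so that η (C‖x‖)² < ε; the added 1 excludes a zero denominator.
      set η : ℝ := ε / (2 * ((C * ‖x‖) ^ 2 + 1)) with hη
      have hηpos : 0 < η := by positivity
      filter_upwards [Metric.tendstoUniformlyOn_iff.1 hs (η / 2) (half_pos hηpos)] with n hn
      have hc : ∀ c ∈ (t n).range, ‖star c - (‖c‖ : ℂ)‖ ≤ η := by
        intro c hc
        rcases (SimpleFunc.mem_restrict_range hK).1 hc with ⟨rfl, -⟩ | ⟨z, hz, rfl⟩
        · simpa using hηpos.le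
        · obtain ⟨r, hr, hrz⟩ := hσ hz
          replace hrz : (r : ℂ) = z := hrz
          have h1 := (hn z hz).le
          rw [dist_comm, dist_eq_norm] at h1
          have h1' : ‖star (s n z) - (r : ℂ)‖ ≤ η / 2 := by
            rwa [← norm_star, star_sub, star_star, RCLike.star_def, Complex.conj_ofReal, hrz]
          have h2 : ‖(r : ℂ) - (‖s n z‖ : ℂ)‖ ≤ η / 2 := by
            rw [← Complex.ofReal_sub, Complex.norm_real, Real.norm_eq_abs, abs_sub_comm]
            have := abs_norm_sub_norm_le (s n z) (r : ℂ)
            rw [Complex.norm_real, Real.norm_of_nonneg hr] at this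
            exact this.trans (by rwa [hrz])
          calc _ = ‖(star (s n z) - (r : ℂ)) + ((r : ℂ) - (‖s n z‖ : ℂ))‖ := by
                rw [sub_add_sub_cancel]
            _ ≤ η / 2 + η / 2 := (norm_add_le _ _).trans (add_le_add h1' h2)
            _ = η := add_halves η
      rw [dist_zero_right, hTn, hZdef]
      simp only
      rw [inner_gram_sum_smul _ _ (hP n) (hPQ n)]
      push_cast
      rw [← Finset.sum_sub_distrib]
      calc _ ≤ ∑ c ∈ (t n).range, η * ‖P n c x‖ ^ 2 := by
            refine (norm_sum_le _ _).trans (Finset.sum_le_sum fun c hc' => ?_)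
            rw [← sub_mul, norm_mul, norm_pow, Complex.norm_real, norm_norm]
            gcongr
            exact hc c hc'
        _ ≤ η * (C * ‖x‖) ^ 2 := by
            rw [← Finset.mul_sum]
            gcongr
            exact hup n x
        _ < ε := by
            rw [hη, div_mul_eq_mul_div, div_lt_iff₀ (by positivity)]
            nlinarith [sq_nonneg (C * ‖x‖)]
    have hdiff : Tendsto (fun n => inner ℂ (Z n (T x)) x - inner ℂ (Z n (Tn n x)) x) atTop
        (𝓝 0) := by
      have h0 : Tendsto (fun n => C ^ 2 * (‖Tn n - T‖ * ‖x‖) * ‖x‖) atTop (𝓝 0) := by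
        have := (((tendsto_iff_norm_sub_tendsto_zero.1 hTlim).mul_const ‖x‖).const_mul
          (C ^ 2)).mul_const ‖x‖
        simpa using this
      refine squeeze_zero_norm (fun n => ?_) h0
      rw [← inner_sub_left, ← map_sub]
      refine (norm_inner_le_norm _ _).trans ?_
      gcongr
      refine (ContinuousLinearMap.le_of_opNorm_le _ (hZ n) _).trans ?_
      gcongr
      rw [norm_sub_rev, ← sub_apply]
      exact (Tn n - T).le_opNorm x
    have hfin := (hZ' (T x) x).sub ((hdiff.add hρ).mono_left Nat.hyperfilter_le_atTop)
    rw [add_zero, sub_zero] at hfin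
    refine hclosed.mem_of_tendsto (hfin.congr (f₂ := fun n =>
      ((∑ c ∈ (t n).range, ‖c‖ * ‖P n c x‖ ^ 2 : ℝ) : ℂ)) fun n => by ring) ?_
    exact Filter.Eventually.of_forall fun n =>
      ⟨by rw [Complex.ofReal_re], by rw [Complex.ofReal_re]; positivity⟩

end Symmetrizers

/-! ### Positivity, square roots and transport by similarity -/

section Similarity

variable {H : Type*} [NormedAddCommGroup H] [InnerProductSpace ℂ H]

theorem isPositive_iff_nonneg {A : H →L[ℂ] H} : A.IsPositive ↔ 0 ≤ A :=
  (ContinuousLinearMap.nonneg_iff_isPositive A).symm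

theorem eq_conj_of_mul_eq {T S : H →L[ℂ] H} {G : (H →L[ℂ] H)ˣ} (h : T * G = G * S) :
    T = G * S * (↑G⁻¹ : H →L[ℂ] H) := by
  rw [← h, Units.mul_inv_cancel_right]

theorem isCompl_closure_range_ker_units_conj {S : H →L[ℂ] H} (G : (H →L[ℂ] H)ˣ)
    (hS : IsCompl S.range.topologicalClosure S.ker) :
    IsCompl (G * S * (↑G⁻¹ : H →L[ℂ] H)).range.topologicalClosure
      (G * S * (↑G⁻¹ : H →L[ℂ] H)).ker := by
  let e := ContinuousLinearEquiv.unitsEquiv ℂ H G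
  have hGi : ∀ x, (↑G⁻¹ : H →L[ℂ] H) ((G : H →L[ℂ] H) x) = x := fun x => by
    rw [← mul_apply_eq_comp, Units.inv_mul, one_apply_eq_self]
  have hiG : ∀ x, (G : H →L[ℂ] H) ((↑G⁻¹ : H →L[ℂ] H) x) = x := fun x => by
    rw [← mul_apply_eq_comp, Units.mul_inv, one_apply_eq_self]
  have hrange : ((G * S * (↑G⁻¹ : H →L[ℂ] H)).range : Set H) = e '' S.range := by
    ext y
    constructor
    · rintro ⟨x, rfl⟩
      exact ⟨_, ⟨(↑G⁻¹ : H →L[ℂ] H) x, rfl⟩, rfl⟩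
    · rintro ⟨_, ⟨x, rfl⟩, rfl⟩
      refine ⟨(G : H →L[ℂ] H) x, ?_⟩
      simp [hGi, e]
  have hker : (G * S * (↑G⁻¹ : H →L[ℂ] H)).ker = S.ker.map e.toLinearEquiv.toLinearMap := by
    ext y
    constructor
    · intro hy
      refine ⟨(↑G⁻¹ : H →L[ℂ] H) y, ?_, hiG y⟩
      exact e.injective (hy.trans (map_zero e).symm)
    · rintro ⟨x, hx, rfl⟩
      have hx' : S x = 0 := hx
      simp [e, hGi, hx']
  have hclos : (G * S * (↑G⁻¹ : H →L[ℂ] H)).range.topologicalClosure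
      = S.range.topologicalClosure.map e.toLinearEquiv.toLinearMap := by
    apply SetLike.coe_injective
    rw [Submodule.topologicalClosure_coe, hrange, ← e.image_closure, Submodule.map_coe,
      Submodule.topologicalClosure_coe]
    rfl
  rw [hclos, hker]
  exact (Submodule.orderIsoMapComap e.toLinearEquiv).isCompl hS

variable [CompleteSpace H]

theorem exists_isUnit_sqrt {A : H →L[ℂ] H} (hA : A.IsPositive) (hu : IsUnit A) :
    ∃ R : (H →L[ℂ] H)ˣ, ContinuousLinearMap.adjoint (R : H →L[ℂ] H) = R ∧ (R : H →L[ℂ] H) * R = A := by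
  have h0 : CFC.sqrt A * CFC.sqrt A = A := CFC.sqrt_mul_sqrt_self A (isPositive_iff_nonneg.1 hA)
  have hR : IsUnit (CFC.sqrt A) := by
    rw [← h0] at hu
    exact ((Commute.refl _).isUnit_mul_iff.1 hu).1
  refine ⟨hR.unit, ?_, h0⟩
  rw [IsUnit.unit_spec]
  exact (isPositive_iff_nonneg.2 (CFC.sqrt_nonneg A)).isSelfAdjoint.adjoint_eq

theorem isPositive_conj {A : H →L[ℂ] H} (hA : A.IsPositive) (B : H →L[ℂ] H) :
    (B * A * ContinuousLinearMap.adjoint B).IsPositive := hA.conj_adjoint B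

theorem isPositive_mul_adjoint (B : H →L[ℂ] H) : (B * ContinuousLinearMap.adjoint B).IsPositive := by
  simpa using isPositive_conj ContinuousLinearMap.isPositive_one B

theorem isUnit_adjoint {B : H →L[ℂ] H} (hB : IsUnit B) : IsUnit (ContinuousLinearMap.adjoint B) := hB.star

theorem adjoint_mul (A B : H →L[ℂ] H) :
    ContinuousLinearMap.adjoint (A * B) = ContinuousLinearMap.adjoint B * ContinuousLinearMap.adjoint A :=
  star_mul A B

/-- Conjugating W by its inverse gives the adjoint of W⁻¹, which is thus positive, hence
selfadjoint, hence equal to W⁻¹. -/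
theorem isPositive_inv (W : (H →L[ℂ] H)ˣ) (hW : (W : H →L[ℂ] H).IsPositive) :
    ((↑W⁻¹ : H →L[ℂ] H)).IsPositive := by
  have h := isPositive_conj hW (↑W⁻¹ : H →L[ℂ] H)
  rw [Units.inv_mul, one_mul] at h
  have h2 := h.isSelfAdjoint.adjoint_eq
  rw [ContinuousLinearMap.adjoint_adjoint] at h2
  rwa [h2]

open scoped ComplexOrder in
theorem spectrumNonneg_of_isPositive {S : H →L[ℂ] H} (hS : S.IsPositive) : SpectrumNonneg S := by
  intro z hz
  have h : 0 ≤ z := spectrum_nonneg_of_nonneg (isPositive_iff_nonneg.1 hS) hz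
  exact ⟨z.re, (Complex.nonneg_iff.1 h).1, Complex.ext rfl (Complex.nonneg_iff.1 h).2⟩

theorem isPositive_of_spectrumNonneg {S : H →L[ℂ] H} (hS : IsSelfAdjoint S)
    (h : SpectrumNonneg S) : S.IsPositive := by
  rw [isPositive_iff_nonneg, nonneg_iff_isSelfAdjoint_and_quasispectrumRestricts,
    quasispectrumRestricts_iff_spectrumRestricts]
  refine ⟨hS, SpectrumRestricts.nnreal_iff.2 fun r hr => ?_⟩
  obtain ⟨r', hr', hrr⟩ := h ((spectrum.algebraMap_mem_iff ℂ).2 hr)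
  have : r' = r := Complex.ofReal_injective hrr
  exact this ▸ hr'

theorem isCompl_closure_range_ker_of_isSelfAdjoint {S : H →L[ℂ] H} (hS : IsSelfAdjoint S) :
    IsCompl S.range.topologicalClosure S.ker := by
  have h1 := S.orthogonal_ker
  rw [hS.adjoint_eq] at h1
  have : CompleteSpace S.ker := S.isClosed_ker.completeSpace_coe
  rw [← h1]
  exact S.ker.isCompl_orthogonal.symm

theorem isScalarOperator_of_mul_eq {T S : H →L[ℂ] H} {G : (H →L[ℂ] H)ˣ} (hS : S.IsPositive)
    (h : T * G = G * S) : IsScalarOperator T ∧ SpectrumNonneg T := by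
  rw [eq_conj_of_mul_eq h]
  have : IsStarNormal S := hS.isSelfAdjoint.isStarNormal
  refine ⟨isScalarOperator_units_conj S G, ?_⟩
  rw [SpectrumNonneg, spectrum.units_conjugate]
  exact spectrumNonneg_of_isPositive hS

end Similarity

end ScalarOperators

/-! ### The equivalences and the splitting of the space -/

open ScalarOperators in
theorem mainTheorem3 {H : Type*} [NormedAddCommGroup H] [InnerProductSpace ℂ H] [CompleteSpace H]
    [TopologicalSpace.SeparableSpace H] (T : H →L[ℂ] H) :
    List.TFAE [
      ∃ G S : H →L[ℂ] H, IsUnit G ∧ S.IsPositive ∧ T * G = G * S,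
      (∃ X : H →L[ℂ] H, IsUnit X ∧ X.IsPositive ∧ T * X = X * ContinuousLinearMap.adjoint T) ∧
        ScalarOperators.SpectrumNonneg T,
      ∃ A B : H →L[ℂ] H, A.IsPositive ∧ B.IsPositive ∧ IsUnit B ∧ T = A * B,
      ∃ A B : H →L[ℂ] H, A.IsPositive ∧ B.IsPositive ∧ IsUnit A ∧ T = A * B,
      ∃ W : H →L[ℂ] H, IsUnit W ∧ W.IsPositive ∧ (T * W).IsPositive,
      ∃ Z : H →L[ℂ] H, IsUnit Z ∧ Z.IsPositive ∧ (Z * T).IsPositive,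
      ScalarOperators.IsScalarOperator T ∧ ScalarOperators.SpectrumNonneg T] ∧
    ((∃ G S : H →L[ℂ] H, IsUnit G ∧ S.IsPositive ∧ T * G = G * S) →
      IsCompl T.range.topologicalClosure T.ker) := by
  constructor
  · tfae_have 1 → 7 := by
      rintro ⟨_, S, ⟨G, rfl⟩, hS, h⟩
      exact isScalarOperator_of_mul_eq hS h
    tfae_have 7 → 6 := fun h => h.1.exists_isPositive_mul h.2
    tfae_have 6 → 4 := by
      rintro ⟨_, ⟨Z, rfl⟩, hZ, hZT⟩
      exact ⟨_, _, isPositive_inv Z hZ, hZT, Units.isUnit _, (Units.inv_mul_cancel_left Z T).symm⟩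
    tfae_have 4 → 1 := by
      rintro ⟨A, B, hA, hB, hu, rfl⟩
      obtain ⟨R, hR, rfl⟩ := exists_isUnit_sqrt hA hu
      -- With A = R², T R = R² B R = R (R B R).
      refine ⟨R, R * B * R, R.isUnit, ?_, by simp only [mul_assoc]⟩
      have := isPositive_conj hB (R : H →L[ℂ] H)
      rwa [hR] at this
    tfae_have 1 → 5 := by
      rintro ⟨G, S, hG, hS, h⟩
      refine ⟨G * ContinuousLinearMap.adjoint G, hG.mul (isUnit_adjoint hG),
        isPositive_mul_adjoint G, ?_⟩
      rw [← mul_assoc, h]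
      exact isPositive_conj hS G
    tfae_have 5 → 3 := by
      rintro ⟨_, ⟨W, rfl⟩, hW, hTW⟩
      exact ⟨_, _, hTW, isPositive_inv W hW, Units.isUnit _, (Units.mul_inv_cancel_right T W).symm⟩
    tfae_have 3 → 1 := by
      rintro ⟨A, B, hA, hB, hu, rfl⟩
      obtain ⟨R, hR, rfl⟩ := exists_isUnit_sqrt hB hu
      -- With B = R², the intertwiner is R⁻¹: T R⁻¹ = A R = R⁻¹ (R A R).
      refine ⟨_, R * A * R, (R⁻¹).isUnit, ?_, ?_⟩
      · have := isPositive_conj hA (R : H →L[ℂ] H)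
        rwa [hR] at this
      · simp only [mul_assoc, Units.mul_inv, mul_one, Units.inv_mul_cancel_left]
    tfae_have 1 → 2 := by
      rintro ⟨_, S, ⟨G, rfl⟩, hS, h⟩
      refine ⟨⟨G * ContinuousLinearMap.adjoint (G : H →L[ℂ] H),
        G.isUnit.mul (isUnit_adjoint G.isUnit), isPositive_mul_adjoint _, ?_⟩,
        (isScalarOperator_of_mul_eq hS h).2⟩
      -- Both sides equal G S G*, because S is selfadjoint.
      rw [← mul_assoc, h, mul_assoc _ (ContinuousLinearMap.adjoint (G : H →L[ℂ] H)), ← adjoint_mul,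
        h, adjoint_mul, hS.isSelfAdjoint.adjoint_eq, mul_assoc]
    tfae_have 2 → 1 := by
      rintro ⟨⟨X, hu, hX, h⟩, hσ⟩
      obtain ⟨R, hR, rfl⟩ := exists_isUnit_sqrt hX hu
      have hRi : ContinuousLinearMap.adjoint (↑R⁻¹ : H →L[ℂ] H) = (↑R⁻¹ : H →L[ℂ] H) := by
        have h1 : ContinuousLinearMap.adjoint (↑R⁻¹ : H →L[ℂ] H) * R = 1 := by
          conv_lhs => rw [← hR, ← adjoint_mul, Units.mul_inv]
          exact star_one _
        exact (Units.eq_inv_of_mul_eq_one_right h1)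
      refine ⟨R, (↑R⁻¹ : H →L[ℂ] H) * T * R, R.isUnit, isPositive_of_spectrumNonneg ?_ ?_, ?_⟩
      -- Cancelling one R on the right of T R² = R² T* expresses T R through T*; this makes R⁻¹ T R
      -- equal to its adjoint R T* R⁻¹.
      · have h2 : T * R = R * (R * (ContinuousLinearMap.adjoint T * (↑R⁻¹ : H →L[ℂ] H))) := by
          rw [← mul_assoc, ← mul_assoc, ← h, mul_assoc, mul_assoc, Units.mul_inv, mul_one]
        rw [ContinuousLinearMap.isSelfAdjoint_iff', adjoint_mul, adjoint_mul, hR, hRi,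
          mul_assoc _ T, h2, Units.inv_mul_cancel_left]
      · rw [SpectrumNonneg, spectrum.units_conjugate']
        exact hσ
      · rw [← mul_assoc, Units.mul_inv_cancel_left]
    tfae_finish
  · rintro ⟨_, S, ⟨G, rfl⟩, hS, h⟩
    rw [eq_conj_of_mul_eq h]
    exact isCompl_closure_range_ker_units_conj G
      (isCompl_closure_range_ker_of_isSelfAdjoint hS.isSelfAdjoint)
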